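/- **Conventions.** Balls are open, $B(y,r)\subset\mathbb R^d$, $\lambda B=B(y,\lambda r)$ for $B=B(y,r)$, and $⨍_E g=\frac1{|E|}\int_E g\,dx$ (Lebesgue measure). For $1<q<\infty$, a nonnegative $\omega\in L^1_{\rm loc}(\mathbb R^d)$ is an $A_q$ weight if $⨍_B\omega\,\big(⨍_B\omega^{-1/(q-1)}\big)^{q-1}\le C_\omega$ for some finite $C_\omega$ and all balls $B$; the least such $C_\omega$ is its $A_q$ constant. A bounded domain (connected open set) $\Omega\subset\mathbb R^d$ is a Lipschitz domain with Lipschitz character controlled by $(M,\rho)$, $M\ge 0$, $\rho>0$, if for every $z\in\partial\Omega$ there are an orthonormal coordinate system $(x',x_d)$ centred at $z$ and a function $\psi:\mathbb R^{d-1}\to\mathbb R$ with $\psi(0)=0$ and Lipschitz constant at most $M$ such that $\Omega\cap B(z,\rho\,{\rm diam}(\Omega))=\{x_d>\psi(x')\}\cap B(z,\rho\,{\rm diam}(\Omega))$. **Theorem.** Let $0<p_0<p<p_1<\infty$, let $\omega$ be an $A_{p/p_0}$ weight in $\mathbb R^d$ and let $\Omega\subset\mathbb R^d$ be a bounded Lipschitz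 domain. Let $c_0>0$, $B_0=B(x_0,r_0)$ with $x_0\in\partial\Omega$ and $0<r_0<c_0\,{\rm diam}(\Omega)$, and let $F,f\in L^p(4B_0\cap\Omega)$. Let $N_1,N_2>1$, $0<c_1<1$ and $\eta\ge0$. For a ball $B\subset 4B_0$ put $$S_B(f)=\sup_{B'}\Big(⨍_{B'\cap\Omega}|f|^{p_0}\Big)^{1/p_0},$$ the supremum being over all balls $B'$ with $B\subset B'\subset 4B_0$ that are centred at a point of $\overline\Omega$. Suppose that for each ball $B=B(y_0,r)$ with $|B|\le c_1r_0^d$ and $8B\subset 4B_0$ (which is automatic if $c_1$ is small enough) such that either $y_0\in 2B_0\cap\partial\Omega$ or $4B\subset 2B_0\cap\Omega$, there exist two measurable functions $F_B$ and $R_B$ on $2B\cap\Omega$ with $|F|\le|F_B|+|R_B|$ a.e. on $2B\cap\Omega$ and $$\Big(⨍_{2B\cap\Omega}|F_B|^{p_0}\Big)^{1/p_0}\le N_1\,S_B(f)+\eta\Big(⨍_{8B\cap\Omega}|F|^{p_0}\Big)^{1/p_0},$$ $$\Big(⨍_{2B\cap\Omega}|R_B|^{p_1}\omega\Big)^{1/p_1}\le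 N_2\Big\{\Big(⨍_{8B\cap\Omega}|F|^{p_0}\Big)^{1/p_0}+S_B(f)\Big\}\Big(⨍_B\omega\Big)^{1/p_1}.$$ Then there exists $\eta_0>0$, depending only on $d,p_0,p_1,p,c_0,c_1,N_2$, (an upper bound for) the $A_{p/p_0}$ constant of $\omega$ and the Lipschitz character $(M,\rho)$ of $\Omega$, such that if $0\le\eta\le\eta_0$, then $$\Big(⨍_{B_0\cap\Omega}|F|^p\omega\Big)^{1/p}\le C\Big(⨍_{4B_0\cap\Omega}|f|^p\omega\Big)^{1/p}+C\Big(⨍_{4B_0\cap\Omega}|F|^{p_0}\Big)^{1/p_0}\Big(⨍_{B_0}\omega\Big)^{1/p},$$ where $C$ depends only on $d,p_0,p_1,p,c_0,c_1,N_1,N_2$, the $A_{p/p_0}$ constant of $\omega$ and $(M,\rho)$. -/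

import Mathlib

open MeasureTheory Metric Set
open scoped ENNReal NNReal

/-- `E d` is Euclidean space of dimension `d`. -/
abbrev E (d : ℕ) : Type := EuclideanSpace ℝ (Fin d)

/-- The `A_q` constant (for `1 < q`) of a nonnegative weight `ω`: the least `K` such that
`(⨍_B ω) (⨍_B ω ^ (-1/(q-1))) ^ (q-1) ≤ K` for every ball `B`.  Everything is computed in `[0, ∞]`,
so that `0 ^ (-1/(q-1)) = ∞`. -/
noncomputable def apConstant {d : ℕ} (q : ℝ) (ω : E d → ℝ) : ℝ≥0∞ :=
  ⨆ (y : E d) (r : ℝ) (_ : 0 < r),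
    (⨍⁻ x in ball y r, ENNReal.ofReal (ω x) ∂volume) *
      (⨍⁻ x in ball y r, ENNReal.ofReal (ω x) ^ (-(1 / (q - 1))) ∂volume) ^ (q - 1)

/-- `ω` is an `A_q` weight on the whole space, `1 < q`. -/
structure IsApWeight {d : ℕ} (q : ℝ) (ω : E d → ℝ) : Prop where
  nonneg : ∀ x, 0 ≤ ω x
  locallyIntegrable : LocallyIntegrable ω
  apConstant_lt_top : apConstant q ω < ∞

/-- `Ω` is a bounded Lipschitz domain whose Lipschitz character is controlled by `M` and `ρ`:
around every boundary point `z`, in the ball of radius `ρ * diam Ω`, the set `Ω` is the region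
above the graph of a function `ψ` on a hyperplane `e^⊥` with Lipschitz constant at most `M`, in
orthonormal coordinates centred at `z` whose last axis is `e`.  (By compactness of the boundary a
bounded Lipschitz domain satisfies this for some `M` and some `ρ > 0`.) -/
structure IsLipschitzDomainWith {d : ℕ} (M : ℝ≥0) (ρ : ℝ) (Ω : Set (E d)) : Prop where
  isOpen : IsOpen Ω
  isConnected : IsConnected Ω
  isBounded : Bornology.IsBounded Ω
  exists_graph : ∀ z ∈ frontier Ω, ∃ (e : E d) (ψ : (ℝ ∙ e)ᗮ → ℝ),
    ‖e‖ = 1 ∧ LipschitzWith M ψ ∧ ψ 0 = 0 ∧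
      ∀ x ∈ ball z (ρ * diam Ω),
        x ∈ Ω ↔ ψ ((ℝ ∙ e)ᗮ.orthogonalProjectionOnto (x - z)) < inner ℝ e (x - z)

/-- The `L^p` average `(⨍_S |g|^p)^{1/p}`, with values in `[0, ∞]`. -/
noncomputable def lpAvg {d : ℕ} (p : ℝ) (S : Set (E d)) (g : E d → ℝ) : ℝ≥0∞ :=
  (⨍⁻ x in S, ‖g x‖ₑ ^ p ∂volume) ^ (1 / p)

/-- The weighted `L^p` average `(⨍_S |g|^p ω)^{1/p}` (the average is with respect to Lebesgue
measure), with values in `[0, ∞]`. -/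
noncomputable def weightedLpAvg {d : ℕ} (p : ℝ) (ω : E d → ℝ) (S : Set (E d)) (g : E d → ℝ) :
    ℝ≥0∞ :=
  (⨍⁻ x in S, ‖g x‖ₑ ^ p * ENNReal.ofReal (ω x) ∂volume) ^ (1 / p)

/-- The supremum of `(⨍_{B' ∩ Ω} |f|^{p}) ^ {1/p}` over all balls `B'` centred at a point of the
closure of `Ω` with `B ⊆ B' ⊆ D`. -/
noncomputable def supLpAvg {d : ℕ} (p : ℝ) (Ω B D : Set (E d)) (f : E d → ℝ) : ℝ≥0∞ :=
  ⨆ (y : E d) (r : ℝ) (_ : y ∈ closure Ω ∧ B ⊆ ball y r ∧ ball y r ⊆ D),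
    lpAvg p (ball y r ∩ Ω) f

/-! ### Volumes of balls. -/

section BallVolume

variable {d : ℕ}

/-! Let `q = p / p₀`, `s = p₁ / p₀`, and let `g`, `h` be `|F| ^ p₀`, `|f| ^ p₀` cut off to 4B₀ ∩ Ω.
The claim bounds the `L^q(w)` norm of `g` on B₀ by that of `h` plus an average of `g`, where `w = ω`
almost everywhere. It comes from a good-λ inequality between the maximal functions Mg and Mh.

If Mg > At at a point x of B₀, there is a stopping radius R: the average of `g` over B(x, R) exceeds
t, but it is at most t over all concentric balls of radius at least 2R (`exists_stopping_radius`).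
For t above a base level l, a multiple of the average of `g`, R is so small that the hypothesis
applies on a comparable ball, centred on the boundary or lying well inside Ω. Either Mh > γt on all
of B(x, R), or the averages of `h` in S_B(f) are small and, near x, `g` is dominated by a multiple
of g₁ + g₂ with g₁ = |F_B| ^ p₀ and g₂ = |R_B| ^ p₀ (`IsNondegenerateAp.exists_majorant`). The
integral of g₁ is at most δt|B|, so its maximal function is large only on a small part of the ball,
small in volume and hence, by the A_∞ property, in `w`-mass. The function g₂ is bounded in `L^s(w)`,
so the weak type (s, s) inequality gains a factor A^(-s) (`exists_local_maxSet_le`). A Vitali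
covering then gives, on B₀, w(Mg > At) ≤ D (w(Mh > γt) + (ε + C A^(-s)) w(Mg > t))
(`IsNondegenerateAp.good_lambda`).

Multiply by (At)^q and sum over t = l A^k. Since q < s, taking A large and then ε small makes the
coefficient A^q D (ε + C A^(-s)) at most 1/2, so the `g`-series is absorbed; the `h`-series is
bounded by Muckenhoupt's maximal theorem (`exists_tsum_maxSet_le`). The constants A, ε, δ and η₀ are
fixed before N₁; only γ and what follows it depend on N₁.

The weight theory comes from one consequence of A_q, `VolumeComparable`. Iterated enlargement turns
it into a quantitative A_∞ property (`VolumeComparable.exists_geometric_decay`), which yields the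
reverse Hölder inequality; applied to the dual weight, this makes A_q an open condition
(`IsNondegenerateAp.exists_lt`). -/

theorem volume_ball_eq (x : E d) {r : ℝ} (hr : 0 < r) :
    volume (ball x r) = ENNReal.ofReal (r ^ d) * volume (ball (0 : E d) 1) := by
  simpa using Measure.addHaar_ball_of_pos (volume : Measure (E d)) x hr

theorem volume_ball_ne_zero (x : E d) {r : ℝ} (hr : 0 < r) : volume (ball x r) ≠ 0 :=
  (measure_ball_pos volume x hr).ne'

theorem volume_ball_ne_top (x : E d) (r : ℝ) : volume (ball x r) ≠ ∞ :=
  measure_ball_lt_top.ne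

theorem volume_ball_mul (x y : E d) {k r : ℝ} (hk : 0 < k) (hr : 0 < r) :
    volume (ball x (k * r)) = ENNReal.ofReal (k ^ d) * volume (ball y r) := by
  rw [volume_ball_eq x (by positivity), volume_ball_eq y hr, mul_pow,
    ENNReal.ofReal_mul (by positivity), mul_assoc]

theorem volume_ball_le_mul (x y : E d) {k r s : ℝ} (hk : 0 < k) (hs : 0 < s) (h : r ≤ k * s) :
    volume (ball x r) ≤ ENNReal.ofReal (k ^ d) * volume (ball y s) := by
  rw [← volume_ball_mul x y hk hs]
  exact measure_mono (ball_subset_ball h)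

theorem radius_le_of_volume_ball_le (hd : 0 < d) {x y : E d} {r s : ℝ} (hr : 0 < r) (hs : 0 < s)
    (h : volume (ball x r) ≤ volume (ball y s)) : r ≤ s := by
  rw [volume_ball_eq x hr, volume_ball_eq y hs,
    ENNReal.mul_le_mul_iff_left (volume_ball_ne_zero _ one_pos) (volume_ball_ne_top _ _),
    ENNReal.ofReal_le_ofReal_iff (by positivity)] at h
  exact le_of_pow_le_pow_left₀ hd.ne' hs.le h

/-- Spheres are null when `d > 0`. This links the closed balls of the Besicovitch differentiation
theorems to the open balls used elsewhere. -/
theorem restrict_closedBall_eq (hd : 0 < d) (x : E d) (r : ℝ) :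
    (volume : Measure (E d)).restrict (closedBall x r) = volume.restrict (ball x r) := by
  have : Nonempty (Fin d) := ⟨⟨0, hd⟩⟩
  refine Measure.restrict_congr_set (ae_eq_symm ?_)
  exact ae_eq_of_subset_of_measure_ge ball_subset_closedBall
    (Measure.addHaar_closedBall_eq_addHaar_ball _ x r).le measurableSet_ball.nullMeasurableSet
    measure_closedBall_lt_top.ne

end BallVolume

/-! ### Vitali covering and superlevel sets of the maximal function. -/

section Covering

variable {d : ℕ}

/-- A global form of the Vitali covering lemma. -/
theorem measure_iUnion_ball_le {ι : Type*} (c : ι → E d) (r : ι → ℝ) (T : ℝ)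
    (hr : ∀ i, 0 < r i) (hT : ∀ i, r i ≤ T) (μ ν : Measure (E d))
    (h : ∀ i, μ (ball (c i) (6 * r i)) ≤ ν (ball (c i) (r i))) :
    μ (⋃ i, ball (c i) (r i)) ≤ ν univ := by
  -- `μ` only sees the enlarged balls and `ν` only the disjoint ones. Keeping two measures lets this
  -- one statement serve the enlargement lemma, both weak type bounds and the good-λ inequality.
  obtain ⟨u, -, hdisj, hcov⟩ := Vitali.exists_disjoint_subfamily_covering_enlargement_ball
    univ c r T (fun i _ => hT i) 6 (by norm_num)
  have hu : u.Countable := hdisj.countable_of_isOpen (fun _ _ => isOpen_ball)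
    (fun i _ => nonempty_ball.2 (hr i))
  calc μ (⋃ i, ball (c i) (r i)) ≤ μ (⋃ i ∈ u, ball (c i) (6 * r i)) := by
        refine measure_mono (iUnion_subset fun i => ?_)
        obtain ⟨j, hj, hij⟩ := hcov i (mem_univ i)
        exact hij.trans (subset_biUnion_of_mem (u := fun i => ball (c i) (6 * r i)) hj)
    _ ≤ ∑' i : u, μ (ball (c i) (6 * r i)) := measure_biUnion_le μ hu _
    _ ≤ ∑' i : u, ν (ball (c i) (r i)) := ENNReal.tsum_le_tsum fun i => h i
    _ = ν (⋃ i ∈ u, ball (c i) (r i)) :=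
        (measure_biUnion hu hdisj fun _ _ => measurableSet_ball).symm
    _ ≤ ν univ := measure_mono (subset_univ _)

/-- The superlevel set at height `t` of the uncentred maximal function of `g` over balls of radius
at most `T`. -/
def maxSet (T : ℝ) (g : E d → ℝ≥0∞) (t : ℝ≥0∞) : Set (E d) :=
  ⋃ i : {i : E d × ℝ // 0 < i.2 ∧ i.2 ≤ T ∧
    t * volume (ball i.1 i.2) < ∫⁻ x in ball i.1 i.2, g x}, ball i.1.1 i.1.2

theorem isOpen_maxSet (T : ℝ) (g : E d → ℝ≥0∞) (t : ℝ≥0∞) : IsOpen (maxSet T g t) :=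
  isOpen_iUnion fun _ => isOpen_ball

theorem mem_maxSet {T : ℝ} {g : E d → ℝ≥0∞} {t : ℝ≥0∞} {x : E d} :
    x ∈ maxSet T g t ↔ ∃ y r, 0 < r ∧ r ≤ T ∧
      t * volume (ball y r) < (∫⁻ z in ball y r, g z) ∧ x ∈ ball y r := by
  simp only [maxSet, mem_iUnion, Subtype.exists, Prod.exists, exists_prop, and_assoc]

theorem ball_subset_maxSet {T : ℝ} {g : E d → ℝ≥0∞} {t : ℝ≥0∞} {y : E d} {r : ℝ} (hr : 0 < r)
    (hT : r ≤ T) (h : t * volume (ball y r) < ∫⁻ z in ball y r, g z) :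
    ball y r ⊆ maxSet T g t := fun _ hx => mem_maxSet.2 ⟨y, r, hr, hT, h, hx⟩

/-- Lebesgue differentiation: the averages over small balls centred at `x` tend to `g x`. The
exceptional null set does not depend on `t`. -/
theorem ae_mem_maxSet (hd : 0 < d) {T : ℝ} (hT : 0 < T) {g : E d → ℝ≥0∞} (hg : AEMeasurable g)
    (hfin : ∫⁻ x, g x ≠ ∞) : ∀ᵐ x, ∀ t, t < g x → x ∈ maxSet T g t := by
  filter_upwards [(Besicovitch.vitaliFamily (volume : Measure (E d))).ae_tendsto_lintegral_div
    hg hfin] with x hx t ht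
  have h1 := (hx.comp (Besicovitch.tendsto_filterAt volume x)).eventually (lt_mem_nhds ht)
  have h2 : ∀ᶠ r in nhdsWithin (0 : ℝ) (Ioi 0), r ∈ Ioc 0 T := Ioc_mem_nhdsGT hT
  obtain ⟨r, hr1, hr2⟩ := (h1.and h2).exists
  simp only [Function.comp] at hr1
  rw [restrict_closedBall_eq hd] at hr1
  have : Nonempty (Fin d) := ⟨⟨0, hd⟩⟩
  rw [Measure.addHaar_closedBall_eq_addHaar_ball, ENNReal.lt_div_iff_mul_lt
    (Or.inl (volume_ball_ne_zero x hr2.1)) (Or.inl (volume_ball_ne_top x r))] at hr1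
  exact ball_subset_maxSet hr2.1 hr2.2 hr1 (mem_ball_self hr2.1)

end Covering

/-! ### Measure density of Lipschitz domains. -/

section LipschitzDomain

variable {d : ℕ}

/-- Otherwise the interior of `t` and the complement of its closure would disconnect `s`. -/
theorem inter_frontier_nonempty_of_isPreconnected {X : Type*} [TopologicalSpace X] {s t : Set X}
    (hs : IsPreconnected s) (h1 : (s ∩ t).Nonempty) (h2 : (s ∩ tᶜ).Nonempty) :
    (s ∩ frontier t).Nonempty := by
  by_contra hemp
  rw [not_nonempty_iff_eq_empty, ← disjoint_iff_inter_eq_empty, disjoint_left] at hemp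
  have hcase : ∀ x ∈ s, x ∈ interior t ∨ x ∈ (closure t)ᶜ := fun x hx => by
    by_contra! hcon
    exact hemp hx ⟨not_not.1 hcon.2, hcon.1⟩
  obtain ⟨a, ha, hat⟩ := h1
  obtain ⟨b, hb, hbt⟩ := h2
  obtain ⟨x, -, hx1, hx2⟩ := hs (interior t) (closure t)ᶜ isOpen_interior
    isClosed_closure.isOpen_compl hcase
    ⟨a, ha, (hcase a ha).resolve_right fun h => h (subset_closure hat)⟩
    ⟨b, hb, (hcase b hb).resolve_left fun h => hbt (interior_subset h)⟩
  exact hx2 (subset_closure (interior_subset hx1))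

/-- The centre is `z + (t / 2) • e`, at height `t / 2` above the graph. A displacement shorter than
`s = t / (2 * (M + 1))` lowers the height by less than `s` and raises the graph by at most `M * s`,
and `(M + 1) * s = t / 2`. -/
theorem IsLipschitzDomainWith.exists_ball_subset {M : ℝ≥0} {ρ : ℝ} {Ω : Set (E d)}
    (h : IsLipschitzDomainWith M ρ Ω) {z : E d} (hz : z ∈ frontier Ω) {t : ℝ} (ht : 0 < t)
    (htρ : t ≤ ρ * diam Ω) :
    ∃ y, ball y (t / (2 * (M + 1))) ⊆ ball z t ∩ Ω := by
  obtain ⟨e, ψ, he, hψ, hψ0, hgraph⟩ := h.exists_graph z hz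
  have hM : (0 : ℝ) < 2 * (M + 1) := by positivity
  set s := t / (2 * (M + 1)) with hs
  have hst : s * (2 * (M + 1)) = t := div_mul_cancel₀ _ hM.ne'
  have hspos : 0 < s := by positivity
  have hs2 : s ≤ t / 2 := by
    have : 0 ≤ s * M := by positivity
    nlinarith
  refine ⟨z + (t / 2) • e, fun x hx => ?_⟩
  set v := x - (z + (t / 2) • e) with hv
  have hvs : ‖v‖ < s := by rwa [mem_ball, dist_eq_norm] at hx
  have hxz : x - z = (t / 2) • e + v := by rw [hv]; abel
  have hxt : x ∈ ball z t := by
    rw [mem_ball, dist_eq_norm, hxz]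
    calc ‖(t / 2) • e + v‖ ≤ ‖(t / 2) • e‖ + ‖v‖ := norm_add_le _ _
      _ < t / 2 + s := by
        rw [norm_smul, he, mul_one, Real.norm_of_nonneg (by positivity)]; linarith
      _ ≤ t := by linarith
  refine ⟨hxt, (hgraph x (ball_subset_ball htρ hxt)).2 ?_⟩
  have hPe : (ℝ ∙ e)ᗮ.orthogonalProjectionOnto e = 0 := by
    apply Submodule.orthogonalProjectionOnto_orthogonal_apply_eq_zero
    exact Submodule.mem_span_singleton_self e
  rw [hxz, map_add, map_smul, hPe, smul_zero, zero_add, inner_add_right, inner_smul_right,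
    real_inner_self_eq_norm_sq, he]
  have h1 : ψ ((ℝ ∙ e)ᗮ.orthogonalProjectionOnto v) ≤ M * ‖v‖ := by
    have := hψ.dist_le_mul ((ℝ ∙ e)ᗮ.orthogonalProjectionOnto v) 0
    rw [hψ0, dist_zero_right, dist_zero_right] at this
    refine (le_abs_self _).trans (this.trans ?_)
    gcongr
    exact Submodule.norm_orthogonalProjectionOnto_apply_le _ _
  have h2 : -‖v‖ ≤ inner ℝ e v := by
    have := abs_real_inner_le_norm e v
    rw [he, one_mul] at this
    exact (abs_le.1 this).1
  have h3 : (M : ℝ) * ‖v‖ ≤ M * s := by gcongr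
  nlinarith

/-- The interior measure density condition of Lipschitz domains. -/
theorem exists_mul_volume_ball_le (M : ℝ≥0) {ρ c : ℝ} (hρ : 0 < ρ) (hc : 0 < c) :
    ∃ θ : ℝ≥0, 0 < θ ∧ ∀ Ω : Set (E d), IsLipschitzDomainWith M ρ Ω → ∀ y ∈ closure Ω,
      ∀ r, 0 < r → r ≤ c * diam Ω → θ * volume (ball y r) ≤ volume (ball y r ∩ Ω) := by
  -- The bound `1 / 2` keeps a ball of radius `m * r` about a frontier point of `ball y (r / 2)`
  -- inside `ball y r`; the bound `ρ / c` puts `m * r` in the range of the graph description.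
  set m := min (1 / 2) (ρ / c) with hm
  have hmpos : 0 < m := by positivity
  have hM : (0 : ℝ) < 2 * (M + 1) := by positivity
  set k := m / (2 * (M + 1)) with hk
  have hkpos : 0 < k := by positivity
  have hk1 : k ≤ 1 / 2 := by
    have h1 : m ≤ 1 / 2 := min_le_left _ _
    rw [hk, div_le_iff₀ hM]
    have : (0 : ℝ) ≤ M := M.2
    nlinarith
  refine ⟨(k ^ d).toNNReal, by simpa using pow_pos hkpos d, fun Ω h y hy r hr hrc => ?_⟩
  suffices hsub : ∃ z, ball z (k * r) ⊆ ball y r ∩ Ω by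
    obtain ⟨z, hz⟩ := hsub
    calc _ = volume (ball z (k * r)) := (volume_ball_mul z y hkpos hr).symm
      _ ≤ _ := measure_mono hz
  by_cases hin : ball y (r / 2) ⊆ Ω
  · refine ⟨y, subset_inter (ball_subset_ball ?_) ((ball_subset_ball ?_).trans hin)⟩ <;>
      nlinarith
  · have h1 : (ball y (r / 2) ∩ Ω).Nonempty :=
      mem_closure_iff_nhds.1 hy _ (ball_mem_nhds _ (by positivity))
    have h2 : (ball y (r / 2) ∩ Ωᶜ).Nonempty := by
      obtain ⟨x, hx, hx'⟩ := not_subset.1 hin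
      exact ⟨x, hx, hx'⟩
    obtain ⟨z, hzy, hz⟩ := inter_frontier_nonempty_of_isPreconnected
      (convex_ball y (r / 2)).isPreconnected h1 h2
    have hmr : 0 < m * r := by positivity
    obtain ⟨x, hx⟩ := h.exists_ball_subset hz hmr (by
      calc m * r ≤ ρ / c * (c * diam Ω) := by gcongr; exact min_le_right _ _
        _ = ρ * diam Ω := by field_simp)
    refine ⟨x, ?_⟩
    have : k * r = m * r / (2 * (M + 1)) := by rw [hk]; ring
    rw [this]
    refine hx.trans (inter_subset_inter_left _ ?_)
    refine ball_subset_ball' ?_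
    have : m * r ≤ 1 / 2 * r := by gcongr; exact min_le_left _ _
    rw [mem_ball] at hzy
    linarith

end LipschitzDomain

/-! ### From comparability with volume to a quantitative A_∞ property. -/

section Comparable

variable {d : ℕ}

/-- A measure such that a measurable subset of a ball which has a fixed proportion of its volume
has a fixed proportion of its mass. -/
def VolumeComparable (K : ℝ≥0) (q : ℝ) (μ : Measure (E d)) : Prop :=
  ∀ y r, 0 < r → ∀ A ⊆ ball y r, MeasurableSet A → ∀ c : ℝ≥0,
    volume (ball y r) ≤ c * volume A → μ (ball y r) ≤ (K * c ^ q : ℝ≥0) * μ A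

/-- Doubling. The balls need not be concentric, which matters when the smaller one has to lie in an
intersection of two balls. -/
theorem VolumeComparable.ball_le {K : ℝ≥0} {q : ℝ} {μ : Measure (E d)}
    (h : VolumeComparable K q μ) {x y : E d} {k r : ℝ} (hk : 0 < k) (hr : 0 < r)
    (hsub : ball y r ⊆ ball x (k * r)) :
    μ (ball x (k * r)) ≤ (K * ((k ^ d).toNNReal) ^ q : ℝ≥0) * μ (ball y r) :=
  h x (k * r) (by positivity) _ hsub measurableSet_ball _ (volume_ball_mul x y hk hr).le

theorem exists_le_volume_ball (hd : 0 < d) {c : ℝ≥0∞} (hc : c ≠ ∞) :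
    ∃ T : ℝ, 0 < T ∧ c ≤ volume (ball (0 : E d) T) := by
  set V := volume (ball (0 : E d) 1)
  have hV0 : V ≠ 0 := volume_ball_ne_zero 0 one_pos
  have hV1 : V ≠ ∞ := volume_ball_ne_top 0 1
  set T := max 1 (c / V).toReal
  have hT : 1 ≤ T := le_max_left _ _
  refine ⟨T, by linarith, ?_⟩
  rw [volume_ball_eq 0 (by linarith), ← ENNReal.div_le_iff hV0 hV1]
  refine ENNReal.le_ofReal_iff_toReal_le (ENNReal.div_ne_top hc hV0) (by positivity) |>.2 ?_
  exact (le_max_right _ _).trans (le_self_pow₀ hT hd.ne')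

/-- Almost every point of a set of finite measure has a ball around it in which the set has
intermediate density. -/
theorem ae_exists_ball_intermediate_density (hd : 0 < d) {A : Set (E d)} (hA : volume A ≠ ∞) :
    ∀ᵐ x ∂volume.restrict A, ∃ r : ℝ, 0 < r ∧
      volume (ball x r) ≤ 2 ^ (d + 1) * volume (A ∩ ball x r) ∧
      2 * volume (A ∩ ball x r) ≤ volume (ball x r) := by
  have : Nonempty (Fin d) := ⟨⟨0, hd⟩⟩
  filter_upwards [Besicovitch.ae_tendsto_measure_inter_div volume A] with x hx
  have h1 := hx.eventually (lt_mem_nhds (a := (2⁻¹ : ℝ≥0∞)) (by simp))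
  have h2 : ∀ᶠ r in nhdsWithin (0 : ℝ) (Ioi 0), 0 < r := self_mem_nhdsWithin
  obtain ⟨r, hr1, hr⟩ := (h1.and h2).exists
  rw [Measure.addHaar_closedBall_eq_addHaar_ball, ← Measure.restrict_apply'
    measurableSet_closedBall, restrict_closedBall_eq hd, Measure.restrict_apply'
    measurableSet_ball, ENNReal.lt_div_iff_mul_lt (Or.inl (volume_ball_ne_zero x hr))
    (Or.inl (volume_ball_ne_top x r)), ← ENNReal.div_eq_inv_mul] at hr1
  have hlow : volume (ball x r) < 2 * volume (A ∩ ball x r) :=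
    (ENNReal.div_lt_iff (by simp) (by simp)).1 hr1 |>.trans_eq (mul_comm _ _)
  -- Near a density point the density exceeds 1/2. Double the radius until it first drops to 1/2 or
  -- less, as it must since `A` has finite volume; the preceding ball had density above 1/2, so at
  -- most a factor `2 ^ d` is lost.
  have hex : ∃ n : ℕ, 2 * volume (A ∩ ball x (2 ^ n * r)) ≤ volume (ball x (2 ^ n * r)) := by
    obtain ⟨T, hT, hT'⟩ := exists_le_volume_ball hd (c := 2 * volume A)
      (ENNReal.mul_ne_top (by simp) hA)
    obtain ⟨n, hn⟩ := pow_unbounded_of_one_lt (T / r) (one_lt_two)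
    rw [div_lt_iff₀ hr] at hn
    refine ⟨n, ?_⟩
    calc 2 * volume (A ∩ ball x (2 ^ n * r)) ≤ 2 * volume A := by gcongr; exact inter_subset_left
      _ ≤ volume (ball (0 : E d) T) := hT'
      _ = volume (ball x T) := (Measure.addHaar_ball_center _ _ _).symm
      _ ≤ _ := measure_mono (ball_subset_ball hn.le)
  classical
  have hspec := Nat.find_spec hex
  have hmin := fun m => Nat.find_min hex (m := m)
  set n := Nat.find hex with hn
  cases hn' : n with
  | zero =>
    rw [hn', pow_zero, one_mul] at hspec
    exact absurd hlow (not_lt.2 hspec)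
  | succ m =>
    have hm := not_le.1 (hmin m (by omega))
    rw [hn'] at hspec
    refine ⟨2 ^ (m + 1) * r, by positivity, ?_, hspec⟩
    have h2m : (2 : ℝ) ^ (m + 1) * r = 2 * (2 ^ m * r) := by ring
    calc volume (ball x (2 ^ (m + 1) * r)) = 2 ^ d * volume (ball x (2 ^ m * r)) := by
          rw [h2m, volume_ball_mul x x two_pos (by positivity), ENNReal.ofReal_pow (by simp)]
          simp
      _ ≤ 2 ^ d * (2 * volume (A ∩ ball x (2 ^ m * r))) := by gcongr
      _ = 2 ^ (d + 1) * volume (A ∩ ball x (2 ^ m * r)) := by ring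
      _ ≤ _ := by
        gcongr
        · simp
        · omega

/-- Enlarging a set of finite volume to a controlled neighbourhood increases its mass by a definite
factor. -/
theorem VolumeComparable.exists_enlargement (hd : 0 < d) (K : ℝ≥0) (q : ℝ) :
    ∃ β : ℝ≥0, β < 1 ∧ ∀ μ : Measure (E d), μ ≪ volume → VolumeComparable K q μ →
      ∀ A : Set (E d), MeasurableSet A → volume A ≠ ∞ → ∃ A' : Set (E d), MeasurableSet A' ∧
        μ A ≤ β * μ A' ∧ volume A' ≤ (6 ^ d * 2 ^ (d + 1)) * volume A ∧
        ∀ x ∈ A', ∃ z ∈ A, ∃ (y : E d) (r : ℝ), 0 < r ∧ dist x z < 2 * r ∧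
          volume (ball y r) ≤ (6 ^ d * 2 ^ (d + 1)) * volume A := by
  -- The first factor is the doubling constant from `r` to `6 * r`. The second compares a ball with
  -- its part outside `A`, which has at least half of its volume.
  set C : ℝ≥0 := (K * (((6 : ℝ) ^ d).toNNReal) ^ q) * (K * 2 ^ q) with hC
  refine ⟨C / (C + 1), (div_lt_one (by positivity)).2 (by simp), fun μ hμ h A hA hfin => ?_⟩
  let ι := {i : E d × ℝ // 0 < i.2 ∧
    volume (ball i.1 i.2) ≤ 2 ^ (d + 1) * volume (A ∩ ball i.1 i.2) ∧
      2 * volume (A ∩ ball i.1 i.2) ≤ volume (ball i.1 i.2)}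
  let A' : Set (E d) := ⋃ i : ι, ball i.1.1 i.1.2
  have hA' : MeasurableSet A' := (isOpen_iUnion fun _ => isOpen_ball).measurableSet
  have hle : ∀ i : ι, volume (ball i.1.1 i.1.2) ≤ 2 ^ (d + 1) * volume A := fun i =>
    i.2.2.1.trans (by gcongr; exact inter_subset_left)
  obtain ⟨T, hT0, hT⟩ := exists_le_volume_ball hd (c := 2 ^ (d + 1) * volume A)
    (ENNReal.mul_ne_top (by simp) hfin)
  have hrad : ∀ i : ι, i.1.2 ≤ T := fun i =>
    radius_le_of_volume_ball_le hd i.2.1 hT0 ((hle i).trans hT)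
  refine ⟨A', hA', ?_, ?_, ?_⟩
  · have hsub : μ A ≤ μ (A ∩ A') := by
      refine measure_mono_ae ?_
      have := ae_exists_ball_intermediate_density hd hfin
      rw [ae_restrict_iff' hA] at this
      filter_upwards [hμ.ae_le this] with x hx hxA
      obtain ⟨r, hr, h1, h2⟩ := hx hxA
      exact ⟨hxA, mem_iUnion.2 ⟨⟨(x, r), hr, h1, h2⟩, mem_ball_self hr⟩⟩
    have hvit : μ A' ≤ C * μ (A' \ A) := by
      have := measure_iUnion_ball_le (fun i : ι => i.1.1) (fun i : ι => i.1.2) T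
        (fun i => i.2.1) hrad μ ((C : ℝ≥0∞) • μ.restrict (A' \ A)) (fun i => ?_)
      · simpa [A'] using this
      · obtain ⟨⟨y, r⟩, hr, h1, h2⟩ := i
        simp only at hr h1 h2 ⊢
        have hsubA : ball y r ⊆ A' := fun x hx => mem_iUnion.2 ⟨⟨(y, r), hr, h1, h2⟩, hx⟩
        have hmeas : volume (A ∩ ball y r) + volume (ball y r \ A) = volume (ball y r) := by
          rw [inter_comm]; exact measure_inter_add_sdiff _ hA
        have h3 : volume (ball y r) ≤ (2 : ℝ≥0) * volume (ball y r \ A) := by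
          have hf := volume_ball_ne_top y r
          have : volume (ball y r) + volume (ball y r) ≤
              volume (ball y r) + 2 * volume (ball y r \ A) := by
            calc _ = 2 * volume (A ∩ ball y r) + 2 * volume (ball y r \ A) := by
                  rw [← mul_add, hmeas, two_mul]
              _ ≤ _ := by gcongr
          exact (ENNReal.add_le_add_iff_left hf).1 this
        calc μ (ball y (6 * r)) ≤ (K * (((6 : ℝ) ^ d).toNNReal) ^ q : ℝ≥0) * μ (ball y r) :=
              h.ball_le (by norm_num) hr (ball_subset_ball (by linarith))
          _ ≤ (K * (((6 : ℝ) ^ d).toNNReal) ^ q : ℝ≥0) *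
              ((K * 2 ^ q : ℝ≥0) * μ (ball y r \ A)) := by
            gcongr
            exact h y r hr _ sdiff_subset (measurableSet_ball.diff hA) 2 h3
          _ = C * μ (ball y r \ A) := by rw [hC, ← mul_assoc, ← ENNReal.coe_mul]
          _ ≤ _ := by
            rw [Measure.smul_apply, smul_eq_mul, Measure.restrict_apply measurableSet_ball]
            gcongr
            exact fun x hx => ⟨hx.1, hsubA hx.1, hx.2⟩
    have hC1 : ((C + 1 : ℝ≥0) : ℝ≥0∞) ≠ 0 := by
      rw [ENNReal.coe_ne_zero]; positivity
    rw [ENNReal.coe_div (by positivity), ← ENNReal.mul_div_right_comm,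
      ENNReal.le_div_iff_mul_le (Or.inl hC1) (Or.inl ENNReal.coe_ne_top)]
    -- Almost all of `A` lies in `A'`, and the mass of `A'` is at most `C` times that of the part
    -- added to `A`; hence the ratio `C / (C + 1)`.
    calc μ A * (C + 1 : ℝ≥0) = C * μ A + μ A := by push_cast; ring
      _ ≤ C * μ (A ∩ A') + C * μ (A' \ A) := by
        gcongr
        exact hsub.trans ((measure_mono inter_subset_right).trans hvit)
      _ = C * μ A' := by rw [← mul_add, inter_comm, measure_inter_add_sdiff _ hA]
  -- The lower density bound controls the volume of each enlarged ball by that of `A` in the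
  -- original ball.
  · have := measure_iUnion_ball_le (fun i : ι => i.1.1) (fun i : ι => i.1.2) T
      (fun i => i.2.1) hrad volume
      ((6 ^ d * 2 ^ (d + 1) : ℝ≥0∞) • volume.restrict A) (fun i => ?_)
    · simpa [A'] using this
    · obtain ⟨⟨y, r⟩, hr, h1, h2⟩ := i
      simp only at hr h1 h2 ⊢
      rw [volume_ball_mul y y (by norm_num) hr, Measure.smul_apply, smul_eq_mul,
        Measure.restrict_apply measurableSet_ball, mul_assoc, inter_comm,
        ENNReal.ofReal_pow (by norm_num)]
      simp only [ENNReal.ofReal_ofNat]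
      gcongr
  · intro x hx
    obtain ⟨⟨⟨y, r⟩, hr, h1, h2⟩, hxi⟩ := mem_iUnion.1 hx
    simp only at hr h1 h2 hxi
    have hne : (A ∩ ball y r).Nonempty := by
      refine nonempty_of_measure_ne_zero (μ := volume) fun h0 => ?_
      rw [h0, mul_zero] at h1
      exact volume_ball_ne_zero y hr (le_antisymm h1 zero_le)
    obtain ⟨z, hzA, hz⟩ := hne
    refine ⟨z, hzA, y, r, hr, ?_, ?_⟩
    · rw [mem_ball] at hxi hz
      linarith [dist_triangle_right x z y]
    · refine (hle ⟨(y, r), hr, h1, h2⟩).trans ?_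
      rw [mul_assoc]
      exact le_mul_of_one_le_left zero_le (one_le_pow₀ (by norm_num))

/-- Enlarge `A` repeatedly: each step multiplies the mass by at least `1 / β` and the volume by at
most `Γ`. A set of relative volume `a ^ k` is so small that after `k` steps it is still inside the
doubled ball, so its mass was at most `β ^ k` times the mass of that ball. -/
theorem VolumeComparable.exists_geometric_decay (hd : 0 < d) (K : ℝ≥0) (q : ℝ) :
    ∃ a β C : ℝ≥0, 0 < a ∧ a < 1 ∧ β < 1 ∧ ∀ μ : Measure (E d), μ ≪ volume →
      VolumeComparable K q μ → ∀ y ρ, 0 < ρ → ∀ k : ℕ, ∀ A ⊆ ball y ρ, MeasurableSet A →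
        volume A ≤ a ^ k * volume (ball y ρ) → μ A ≤ C * β ^ k * μ (ball y ρ) := by
  obtain ⟨β, hβ, hstep⟩ := VolumeComparable.exists_enlargement hd K q
  set Γ : ℝ≥0 := 6 ^ d * 2 ^ (d + 1) with hΓ
  have hΓ1 : 1 ≤ Γ := one_le_mul (one_le_pow₀ (by norm_num)) (one_le_pow₀ (by norm_num))
  have hΓ0 : 0 < Γ := by positivity
  have hΓe : (6 ^ d * 2 ^ (d + 1) : ℝ≥0∞) = Γ := by simp [hΓ]
  rw [hΓe] at hstep
  -- Since `Γ * a = (1 / 4) ^ d`, the balls used when `k + 1` steps remain have radius at most `(1 /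
  -- 4) ^ (k + 1) * ρ`. Points move by less than twice that, hence by at most `(1 / 2) ^ (k + 1) *
  -- ρ`, and these moves are summable.
  set a : ℝ≥0 := (1 / 4) ^ d / Γ with ha
  have hΓa : Γ * a = (1 / 4) ^ d := by rw [ha]; field_simp
  have h4 : ((1 : ℝ≥0) / 4) ^ d < 1 := pow_lt_one₀ (by positivity) (by
    rw [div_lt_one (by norm_num)]; norm_num) hd.ne'
  have ha4 : a ≤ (1 / 4) ^ d := div_le_self (by positivity) hΓ1
  refine ⟨a, β, K * (((2 : ℝ) ^ d).toNNReal) ^ q, by positivity, ha4.trans_lt h4, hβ,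
    fun μ hμ h y ρ hρ => ?_⟩
  -- The radius `s` of the ball containing `A` varies in the induction, while volumes are always
  -- measured against `ball y ρ`.
  have key : ∀ k : ℕ, ∀ s, 0 < s → ∀ A ⊆ ball y s, MeasurableSet A →
      volume A ≤ a ^ k * volume (ball y ρ) →
      μ A ≤ β ^ k * μ (ball y (s + (1 - (1 / 2) ^ k) * ρ)) := by
    intro k
    induction k with
    | zero =>
      intro s hs A hA _ _
      simpa using measure_mono hA
    | succ k ih =>
      intro s hs A hA hAm hvol
      have hfin : volume A ≠ ∞ := ((measure_mono hA).trans_lt measure_ball_lt_top).ne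
      obtain ⟨A', hA'm, h1, h2, h3⟩ := hstep μ hμ h A hAm hfin
      have hvol' : Γ * volume A ≤ (((1 / 4) ^ d * a ^ k : ℝ≥0) : ℝ≥0∞) * volume (ball y ρ) := by
        calc Γ * volume A ≤ Γ * (a ^ (k + 1) * volume (ball y ρ)) := by gcongr
          _ = _ := by
            rw [← hΓa]; push_cast; ring
      have hhalf : ((1 : ℝ) / 4) ^ (k + 1) * 2 ≤ (1 / 2) ^ (k + 1) := by
        have h5 : ((1 : ℝ) / 4) ^ (k + 1) = (1 / 2) ^ (k + 1) * (1 / 2) ^ (k + 1) := by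
          rw [← mul_pow]; norm_num
        have h6 : ((1 : ℝ) / 2) ^ (k + 1) ≤ 1 / 2 := by
          rw [pow_succ]
          have : ((1 : ℝ) / 2) ^ k ≤ 1 := pow_le_one₀ (by norm_num) (by norm_num)
          linarith
        have h7 : (0 : ℝ) < (1 / 2) ^ (k + 1) := by positivity
        nlinarith
      have hsub : A' ⊆ ball y (s + (1 / 2) ^ (k + 1) * ρ) := by
        intro x hx
        obtain ⟨z, hz, y', r, hr, hxz, hb⟩ := h3 x hx
        have hr' : r ≤ (1 / 4) ^ (k + 1) * ρ := by
          refine radius_le_of_volume_ball_le hd (y := y) hr (by positivity)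
            (hb.trans (hvol'.trans ?_))
          rw [volume_ball_mul y y (by positivity) hρ]
          gcongr
          rw [ENNReal.ofReal, ENNReal.coe_le_coe, ← NNReal.coe_le_coe, Real.coe_toNNReal _
            (by positivity)]
          push_cast
          calc ((1 : ℝ) / 4) ^ d * (a : ℝ) ^ k ≤ (1 / 4) ^ d * ((1 / 4) ^ d) ^ k := by
                gcongr
                exact_mod_cast ha4
            _ = _ := by rw [← pow_succ', ← pow_mul, ← pow_mul, mul_comm]
        have hzy : dist z y < s := hA hz
        rw [mem_ball]
        have := dist_triangle x z y
        nlinarith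
      have hP := ih (s + (1 / 2) ^ (k + 1) * ρ) (by positivity) A' hsub hA'm (by
        refine (h2.trans hvol').trans ?_
        gcongr
        rw [← ENNReal.coe_pow, ENNReal.coe_le_coe]
        exact mul_le_of_le_one_left (by positivity) h4.le)
      calc μ A ≤ β * μ A' := h1
        _ ≤ β * (β ^ k * μ (ball y (s + (1 / 2) ^ (k + 1) * ρ + (1 - (1 / 2) ^ k) * ρ))) := by
          gcongr
        _ = _ := by
          have hrad : s + (1 / 2) ^ (k + 1) * ρ + (1 - (1 / 2) ^ k) * ρ =
              s + (1 - (1 / 2) ^ (k + 1)) * ρ := by ring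
          rw [← mul_assoc, ← pow_succ', hrad]
  intro k A hA hAm hvol
  calc μ A ≤ β ^ k * μ (ball y (ρ + (1 - (1 / 2) ^ k) * ρ)) := key k ρ hρ A hA hAm hvol
    _ ≤ β ^ k * μ (ball y (2 * ρ)) := by
      gcongr
      have : 0 < ((1 : ℝ) / 2) ^ k := by positivity
      nlinarith
    _ ≤ β ^ k * ((K * (((2 : ℝ) ^ d).toNNReal) ^ q : ℝ≥0) * μ (ball y ρ)) := by
      gcongr
      exact h.ball_le two_pos hρ (ball_subset_ball (by linarith))
    _ = _ := by ring

end Comparable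

/-! ### Muckenhoupt weights: duality, comparability, weak type bounds. -/

section Weights

variable {d : ℕ}

/-- A non-degenerate `A_q` weight with values in `[0, ∞]`, with a division-free form of the `A_q`
condition with constant `K`. -/
structure IsNondegenerateAp (q : ℝ) (K : ℝ≥0) (w : E d → ℝ≥0∞) : Prop where
  measurable : Measurable w
  ne_zero : ∀ y r, 0 < r → ∫⁻ x in ball y r, w x ≠ 0
  ne_top : ∀ y r, 0 < r → ∫⁻ x in ball y r, w x ≠ ∞
  le : ∀ y r, 0 < r → (∫⁻ x in ball y r, w x) *
    (∫⁻ x in ball y r, w x ^ (-(1 / (q - 1)))) ^ (q - 1) ≤ K * volume (ball y r) ^ q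

variable {q : ℝ} {K : ℝ≥0} {w : E d → ℝ≥0∞}

namespace IsNondegenerateAp

theorem dual_ne_top (h : IsNondegenerateAp q K w) (hq : 1 < q) {y : E d} {r : ℝ} (hr : 0 < r) :
    ∫⁻ x in ball y r, w x ^ (-(1 / (q - 1))) ≠ ∞ := by
  intro htop
  have := h.le y r hr
  rw [htop, ENNReal.top_rpow_of_pos (by linarith), ENNReal.mul_top (h.ne_zero y r hr),
    top_le_iff] at this
  exact ENNReal.mul_ne_top ENNReal.coe_ne_top
    (ENNReal.rpow_ne_top_of_nonneg (by linarith) (volume_ball_ne_top y r)) this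

theorem dual_ne_zero (h : IsNondegenerateAp q K w) (hq : 1 < q) {y : E d} {r : ℝ} (hr : 0 < r) :
    ∫⁻ x in ball y r, w x ^ (-(1 / (q - 1))) ≠ 0 := by
  intro h0
  rw [lintegral_eq_zero_iff (h.measurable.pow_const _)] at h0
  have hlt := ae_lt_top h.measurable (h.ne_top y r hr)
  have hfalse : ∀ᵐ x ∂(volume.restrict (ball y r)), False := by
    filter_upwards [h0, hlt] with x hx1 hx2
    simp only [Pi.zero_apply, ENNReal.rpow_eq_zero_iff] at hx1
    have hpos : 0 < 1 / (q - 1) := one_div_pos.2 (by linarith)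
    rcases hx1 with hx1 | hx1
    · linarith [hx1.2]
    · exact hx2.ne hx1.1
  rw [Filter.eventually_false_iff_eq_bot, ae_eq_bot, Measure.restrict_eq_zero] at hfalse
  exact volume_ball_ne_zero y hr hfalse

theorem ae_pos_lt_top (h : IsNondegenerateAp q K w) (hq : 1 < q) {y : E d} {r : ℝ} (hr : 0 < r) :
    ∀ᵐ x ∂(volume.restrict (ball y r)), w x ≠ 0 ∧ w x ≠ ∞ := by
  filter_upwards [ae_lt_top h.measurable (h.ne_top y r hr),
    ae_lt_top (h.measurable.pow_const _) (h.dual_ne_top hq hr)] with x hx1 hx2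
  refine ⟨fun h0 => ?_, hx1.ne⟩
  rw [h0, ENNReal.zero_rpow_of_neg (by simpa using hq)] at hx2
  exact hx2.ne rfl

/-- Raising the A_q inequality to the power `1 / (q - 1)` exchanges the roles of its two factors. -/
theorem dual (h : IsNondegenerateAp q K w) (hq : 1 < q) :
    IsNondegenerateAp (q / (q - 1)) (K ^ (1 / (q - 1))) fun x => w x ^ (-(1 / (q - 1))) where
  measurable := h.measurable.pow_const _
  ne_zero _ _ hr := h.dual_ne_zero hq hr
  ne_top _ _ hr := h.dual_ne_top hq hr
  le y r hr := by
    have hq1 : q - 1 ≠ 0 := by linarith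
    have he : q / (q - 1) - 1 = 1 / (q - 1) := by field_simp; ring
    have := ENNReal.rpow_le_rpow (h.le y r hr) (z := 1 / (q - 1)) (by
      have : 0 < q - 1 := by linarith
      positivity)
    have hz : 0 ≤ 1 / (q - 1) := by
      have : 0 < q - 1 := by linarith
      positivity
    rw [ENNReal.mul_rpow_of_nonneg _ _ hz, ENNReal.mul_rpow_of_nonneg _ _ hz,
      ← ENNReal.rpow_mul, ← ENNReal.rpow_mul, mul_one_div_cancel hq1, ENNReal.rpow_one,
      mul_one_div, ← ENNReal.coe_rpow_of_nonneg _ hz, mul_comm] at this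
    rw [he]
    convert this using 4
    funext x
    rw [← ENNReal.rpow_mul]
    have : -(1 / (q - 1)) * -(1 / (1 / (q - 1))) = 1 := by field_simp
    rw [this, ENNReal.rpow_one]

/-- The `A_q` condition bounds averages by weighted averages. -/
theorem lintegral_rpow_mul_le (h : IsNondegenerateAp q K w) (hq : 1 < q) {y : E d} {r : ℝ}
    (hr : 0 < r) {g : E d → ℝ≥0∞} (hg : AEMeasurable g (volume.restrict (ball y r))) :
    (∫⁻ x in ball y r, g x) ^ q * ∫⁻ x in ball y r, w x ≤
      K * volume (ball y r) ^ q * ∫⁻ x in ball y r, g x ^ q * w x := by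
  have hq0 : 0 < q := by linarith
  have hq1 : 0 < q - 1 := by linarith
  -- Hölder for `g = (g ^ q * w) ^ (1 / q) * w ^ (-(1 / q))`, legitimate where `w` is neither 0 nor
  -- infinite.
  have hH := ENNReal.lintegral_mul_norm_pow_le (μ := volume.restrict (ball y r))
    (f := fun x => g x ^ q * w x) (g := fun x => w x ^ (-(1 / (q - 1))))
    ((hg.pow_const q).mul h.measurable.aemeasurable) (h.measurable.pow_const _).aemeasurable
    (p := 1 / q) (q := (q - 1) / q) (by positivity) (by positivity) (by field_simp; ring)
  have hcongr : ∫⁻ x in ball y r, (g x ^ q * w x) ^ (1 / q) *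
      (w x ^ (-(1 / (q - 1)))) ^ ((q - 1) / q) = ∫⁻ x in ball y r, g x := by
    refine lintegral_congr_ae ?_
    filter_upwards [h.ae_pos_lt_top hq hr] with x hx
    have he : -(1 / (q - 1)) * ((q - 1) / q) = -(1 / q) := by field_simp
    rw [ENNReal.mul_rpow_of_nonneg _ _ (by positivity), ← ENNReal.rpow_mul, ← ENNReal.rpow_mul, he,
      mul_one_div_cancel hq0.ne', ENNReal.rpow_one, mul_assoc, ← ENNReal.rpow_add _ _ hx.1 hx.2,
      add_neg_cancel, ENNReal.rpow_zero, mul_one]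
  rw [hcongr] at hH
  have hH' := ENNReal.rpow_le_rpow hH hq0.le
  rw [ENNReal.mul_rpow_of_nonneg _ _ hq0.le, ← ENNReal.rpow_mul, ← ENNReal.rpow_mul,
    one_div_mul_cancel hq0.ne', ENNReal.rpow_one, div_mul_cancel₀ _ hq0.ne'] at hH'
  calc _ ≤ (∫⁻ x in ball y r, g x ^ q * w x) *
        (∫⁻ x in ball y r, w x ^ (-(1 / (q - 1)))) ^ (q - 1) * ∫⁻ x in ball y r, w x := by gcongr
    _ = (∫⁻ x in ball y r, g x ^ q * w x) * ((∫⁻ x in ball y r, w x) *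
        (∫⁻ x in ball y r, w x ^ (-(1 / (q - 1)))) ^ (q - 1)) := by ring
    _ ≤ (∫⁻ x in ball y r, g x ^ q * w x) * (K * volume (ball y r) ^ q) := by
      gcongr _ * ?_
      exact h.le y r hr
    _ = _ := mul_comm _ _

/-- This is `lintegral_rpow_mul_le` for the indicator function of `A`. -/
theorem volumeComparable (h : IsNondegenerateAp q K w) (hq : 1 < q) :
    VolumeComparable K q (volume.withDensity w : Measure (E d)) := by
  intro y r hr A hA hAm c hc
  have hq0 : 0 < q := by linarith
  have hH := h.lintegral_rpow_mul_le hq (y := y) hr (g := A.indicator 1)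
    ((measurable_one.indicator hAm).aemeasurable)
  have h1 : ∫⁻ x in ball y r, A.indicator (1 : E d → ℝ≥0∞) x = volume A := by
    rw [lintegral_indicator_one hAm, Measure.restrict_apply hAm, inter_eq_left.2 hA]
  have h2 : ∫⁻ x in ball y r, A.indicator (1 : E d → ℝ≥0∞) x ^ q * w x =
      volume.withDensity w A := by
    rw [withDensity_apply _ hAm, ← inter_eq_left.2 hA, ← Measure.restrict_restrict hAm,
      ← lintegral_indicator hAm, inter_eq_left.2 hA]
    refine lintegral_congr fun x => ?_
    by_cases hx : x ∈ A <;> simp [hx, hq0]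
  rw [h1, h2] at hH
  rw [withDensity_apply _ measurableSet_ball]
  have hA0 : volume A ≠ 0 := fun h0 => by
    rw [h0, mul_zero] at hc
    exact volume_ball_ne_zero y hr (le_antisymm hc zero_le)
  have hA1 : volume A ≠ ∞ := ((measure_mono hA).trans_lt measure_ball_lt_top).ne
  have hA0' : volume A ^ q ≠ 0 := by simp [ENNReal.rpow_eq_zero_iff, hA0, hA1]
  have hA1' : volume A ^ q ≠ ∞ := ENNReal.rpow_ne_top_of_nonneg hq0.le hA1
  rw [← ENNReal.mul_le_mul_iff_right hA0' hA1']
  calc _ ≤ _ := hH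
    _ ≤ K * (c * volume A) ^ q * volume.withDensity w A := by gcongr
    _ = _ := by
      rw [ENNReal.mul_rpow_of_nonneg _ _ hq0.le, ENNReal.coe_mul,
        ENNReal.coe_rpow_of_nonneg _ hq0.le]
      ring

/-- By Hölder the dual average for `s` is at most the one for `q`, as `1 / (s - 1) ≤ 1 / (q - 1)`.
-/
theorem mono (h : IsNondegenerateAp q K w) (hq : 1 < q) {s : ℝ} (hqs : q ≤ s) :
    IsNondegenerateAp s K w where
  measurable := h.measurable
  ne_zero := h.ne_zero
  ne_top := h.ne_top
  le y r hr := by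
    have hq1 : 0 < q - 1 := by linarith
    have hs1 : 0 < s - 1 := by linarith
    have hH := ENNReal.lintegral_mul_norm_pow_le (μ := volume.restrict (ball y r))
      (f := fun x => w x ^ (-(1 / (q - 1)))) (g := fun _ => 1)
      (h.measurable.pow_const _).aemeasurable aemeasurable_const
      (p := (q - 1) / (s - 1)) (q := (s - q) / (s - 1)) (by positivity)
      (div_nonneg (by linarith) hs1.le) (by field_simp; ring)
    have he : -(1 / (q - 1)) * ((q - 1) / (s - 1)) = -(1 / (s - 1)) := by field_simp
    simp only [← ENNReal.rpow_mul, he, ENNReal.one_rpow, mul_one, lintegral_const, one_mul,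
      Measure.restrict_apply MeasurableSet.univ, univ_inter] at hH
    have hH' := ENNReal.rpow_le_rpow hH hs1.le
    rw [ENNReal.mul_rpow_of_nonneg _ _ hs1.le, ← ENNReal.rpow_mul, ← ENNReal.rpow_mul,
      div_mul_cancel₀ _ hs1.ne', div_mul_cancel₀ _ hs1.ne'] at hH'
    calc _ ≤ (∫⁻ x in ball y r, w x) * ((∫⁻ x in ball y r, w x ^ (-(1 / (q - 1)))) ^ (q - 1) *
          volume (ball y r) ^ (s - q)) := by gcongr
      _ = ((∫⁻ x in ball y r, w x) * (∫⁻ x in ball y r, w x ^ (-(1 / (q - 1)))) ^ (q - 1)) *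
          volume (ball y r) ^ (s - q) := by ring
      _ ≤ K * volume (ball y r) ^ q * volume (ball y r) ^ (s - q) := by
        gcongr ?_ * _
        exact h.le y r hr
      _ = _ := by
        rw [mul_assoc, ← ENNReal.rpow_add _ _ (volume_ball_ne_zero y hr) (volume_ball_ne_top y r)]
        congr 2
        ring

end IsNondegenerateAp

/-- The weak type `(1, 1)` inequality for the maximal function with respect to Lebesgue
measure. -/
theorem mul_volume_maxSet_le (T : ℝ) (g : E d → ℝ≥0∞) (t : ℝ≥0∞) :
    t * volume (maxSet T g t) ≤ 6 ^ d * ∫⁻ x, g x := by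
  have := measure_iUnion_ball_le
    (fun i : {i : E d × ℝ // 0 < i.2 ∧ i.2 ≤ T ∧
      t * volume (ball i.1 i.2) < ∫⁻ x in ball i.1 i.2, g x} => i.1.1) (fun i => i.1.2) T
    (fun i => i.2.1) (fun i => i.2.2.1) (t • volume) ((6 ^ d : ℝ≥0∞) • volume.withDensity g)
    (fun i => ?_)
  · simpa [maxSet] using this
  · obtain ⟨⟨y, r⟩, hr, h1, h2⟩ := i
    simp only at hr h1 h2 ⊢
    rw [Measure.smul_apply, Measure.smul_apply, smul_eq_mul, smul_eq_mul,
      volume_ball_mul y y (by norm_num) hr, withDensity_apply _ measurableSet_ball,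
      ENNReal.ofReal_pow (by norm_num), mul_left_comm]
    simp only [ENNReal.ofReal_ofNat]
    gcongr

/-- On a ball where the average of `g` exceeds `t`, the A_q condition gives `t ^ q * w(B) ≤ K ∫_B g
^ q w`. Doubling and the Vitali covering do the rest. -/
theorem IsNondegenerateAp.rpow_mul_maxSet_le (h : IsNondegenerateAp q K w) (hq : 1 < q) (T : ℝ)
    {g : E d → ℝ≥0∞} (hg : AEMeasurable g) (t : ℝ≥0∞) :
    t ^ q * volume.withDensity w (maxSet T g t) ≤
      (K * ((6 : ℝ) ^ d).toNNReal ^ q * K : ℝ≥0) * ∫⁻ x, g x ^ q * w x := by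
  have hq0 : 0 < q := by linarith
  have := measure_iUnion_ball_le
    (fun i : {i : E d × ℝ // 0 < i.2 ∧ i.2 ≤ T ∧
      t * volume (ball i.1 i.2) < ∫⁻ x in ball i.1 i.2, g x} => i.1.1) (fun i => i.1.2) T
    (fun i => i.2.1) (fun i => i.2.2.1) (t ^ q • volume.withDensity w)
    (((K * ((6 : ℝ) ^ d).toNNReal ^ q * K : ℝ≥0) : ℝ≥0∞) •
      volume.withDensity fun x => g x ^ q * w x)
    (fun i => ?_)
  · simpa [maxSet] using this
  · obtain ⟨⟨y, r⟩, hr, h1, h2⟩ := i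
    simp only at hr h1 h2 ⊢
    rw [Measure.smul_apply, Measure.smul_apply, smul_eq_mul, smul_eq_mul,
      withDensity_apply (fun x => g x ^ q * w x) measurableSet_ball]
    have hd := (h.volumeComparable hq).ball_le (x := y) (y := y) (k := 6) (by norm_num) hr
      (ball_subset_ball (by linarith))
    have hb : t ^ q * volume.withDensity w (ball y r) ≤ K * ∫⁻ x in ball y r, g x ^ q * w x := by
      have hV0 : volume (ball y r) ^ q ≠ 0 := by
        simp [ENNReal.rpow_eq_zero_iff, volume_ball_ne_zero y hr, volume_ball_ne_top y r]
      have hV1 : volume (ball y r) ^ q ≠ ∞ :=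
        ENNReal.rpow_ne_top_of_nonneg hq0.le (volume_ball_ne_top y r)
      rw [← ENNReal.mul_le_mul_iff_right hV0 hV1, withDensity_apply _ measurableSet_ball]
      calc _ = (t * volume (ball y r)) ^ q * ∫⁻ x in ball y r, w x := by
            rw [ENNReal.mul_rpow_of_nonneg _ _ hq0.le]; ring
        _ ≤ (∫⁻ x in ball y r, g x) ^ q * ∫⁻ x in ball y r, w x := by gcongr
        _ ≤ K * volume (ball y r) ^ q * ∫⁻ x in ball y r, g x ^ q * w x :=
          h.lintegral_rpow_mul_le hq hr hg.restrict
        _ = _ := by ring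
    calc _ ≤ t ^ q * ((K * ((6 : ℝ) ^ d).toNNReal ^ q : ℝ≥0) *
          volume.withDensity w (ball y r)) := by gcongr
      _ = (K * ((6 : ℝ) ^ d).toNNReal ^ q : ℝ≥0) *
          (t ^ q * volume.withDensity w (ball y r)) := by ring
      _ ≤ (K * ((6 : ℝ) ^ d).toNNReal ^ q : ℝ≥0) * (K * ∫⁻ x in ball y r, g x ^ q * w x) := by
        gcongr
      _ = _ := by rw [← mul_assoc, ← ENNReal.coe_mul]

end Weights

/-! ### The reverse Hölder inequality and openness of the A_q condition. -/

section ReverseHolder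

variable {d : ℕ}

/-- A discrete layer cake bound. -/
theorem rpow_le_add_tsum_indicator {q : ℝ} (hq : 0 ≤ q) {l : ℝ≥0∞} (hl0 : l ≠ 0) (hl : l ≠ ∞)
    {A : ℝ≥0} (hA : 1 < A) {X : Type*} (v : X → ℝ≥0∞) {x : X} (hx : v x ≠ ∞) :
    v x ^ q ≤ l ^ q + A ^ q * ∑' k : ℕ, {z | l * A ^ k < v z}.indicator
      (fun _ => (l * A ^ k) ^ q) x := by
  classical
  by_cases hle : v x ≤ l
  · exact (ENNReal.rpow_le_rpow hle hq).trans le_self_add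
  -- Take the first such `k`. It is positive, and the single term at level `k - 1` already dominates
  -- `v x ^ q` up to the factor `A ^ q`.
  · have hex : ∃ k : ℕ, v x ≤ l * A ^ k := by
      have hfin : v x / l ≠ ∞ := ENNReal.div_ne_top hx hl0
      lift v x / l to ℝ≥0 using hfin with y hy
      obtain ⟨k, hk⟩ := pow_unbounded_of_one_lt y hA
      refine ⟨k, ?_⟩
      rw [mul_comm, ← ENNReal.div_le_iff hl0 hl, ← hy]
      exact_mod_cast hk.le
    have hspec := Nat.find_spec hex
    have hmin := fun m => Nat.find_min hex (m := m)
    cases hn : Nat.find hex with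
    | zero => rw [hn] at hspec; simp only [pow_zero, mul_one] at hspec; exact absurd hspec hle
    | succ j =>
      have hj := not_le.1 (hmin j (by omega))
      rw [hn] at hspec
      calc v x ^ q ≤ (A * (l * A ^ j)) ^ q := by
            refine ENNReal.rpow_le_rpow (hspec.trans_eq ?_) hq
            ring
        _ = A ^ q * {z | l * A ^ j < v z}.indicator (fun _ => (l * A ^ j) ^ q) x := by
          rw [ENNReal.mul_rpow_of_nonneg _ _ hq, indicator_of_mem (by exact hj)]
        _ ≤ A ^ q * ∑' k : ℕ, {z | l * A ^ k < v z}.indicator (fun _ => (l * A ^ k) ^ q) x := by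
          gcongr
          exact ENNReal.le_tsum (f := fun k : ℕ =>
            {z | l * A ^ k < v z}.indicator (fun _ => (l * A ^ k) ^ q) x) j
        _ ≤ _ := le_add_self

theorem lintegral_rpow_le_add_tsum {X : Type*} [MeasurableSpace X] {μ : Measure X} {q : ℝ}
    (hq : 0 ≤ q) {l : ℝ≥0∞} (hl0 : l ≠ 0) (hl : l ≠ ∞) {A : ℝ≥0} (hA : 1 < A) {v : X → ℝ≥0∞}
    (hv : AEMeasurable v μ) (hfin : ∀ᵐ x ∂μ, v x ≠ ∞) :
    ∫⁻ x, v x ^ q ∂μ ≤ l ^ q * μ univ +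
      A ^ q * ∑' k : ℕ, (l * A ^ k) ^ q * μ {x | l * A ^ k < v x} := by
  have hms : ∀ k : ℕ, NullMeasurableSet {x | l * A ^ k < v x} μ :=
    fun k => nullMeasurableSet_lt aemeasurable_const hv
  calc ∫⁻ x, v x ^ q ∂μ ≤ ∫⁻ x, (l ^ q + A ^ q * ∑' k : ℕ, {z | l * A ^ k < v z}.indicator
        (fun _ => (l * A ^ k) ^ q) x) ∂μ := by
        refine lintegral_mono_ae ?_
        filter_upwards [hfin] with x hx
        exact rpow_le_add_tsum_indicator hq hl0 hl hA v hx
    _ = _ := by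
      rw [lintegral_add_left measurable_const, lintegral_const, lintegral_const_mul'
        _ _ (ENNReal.rpow_ne_top_of_nonneg hq ENNReal.coe_ne_top), lintegral_tsum]
      · simp_rw [lintegral_indicator_const₀ (hms _)]
      · exact fun k => aemeasurable_const.indicator₀ (hms k)

/-- Continuity at `τ = 0`. The exponent makes the geometric series of the reverse Hölder inequality
converge. -/
theorem exists_rpow_neg_mul_lt_one {a β : ℝ≥0} (ha : 0 < a) (hβ : β < 1) :
    ∃ τ : ℝ, 0 < τ ∧ (a⁻¹) ^ τ * β < 1 := by
  have hcont : Filter.Tendsto (fun τ : ℝ => (a⁻¹) ^ τ * β) (nhdsWithin 0 (Ioi 0)) (nhds β) := by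
    have h1 : Filter.Tendsto (fun τ : ℝ => (a⁻¹) ^ τ * β) (nhds 0) (nhds ((a⁻¹) ^ (0 : ℝ) * β)) :=
      (((NNReal.continuousAt_rpow (x := a⁻¹) (y := 0) (Or.inl (by positivity))).comp
        (by fun_prop : ContinuousAt (fun τ : ℝ => (a⁻¹, τ)) 0)).tendsto.mul_const β)
    rw [NNReal.rpow_zero, one_mul] at h1
    exact h1.mono_left nhdsWithin_le_nhds
  have h2 : ∀ᶠ τ in nhdsWithin (0 : ℝ) (Ioi 0), 0 < τ := self_mem_nhdsWithin
  obtain ⟨τ, h3, h4⟩ := ((hcont.eventually (gt_mem_nhds hβ)).and h2).exists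
  exact ⟨τ, h4, h3⟩

/-- The reverse Hölder inequality. -/
theorem exists_reverse_holder (hd : 0 < d) (K : ℝ≥0) (q : ℝ) :
    ∃ (τ : ℝ) (C : ℝ≥0), 0 < τ ∧ ∀ v : E d → ℝ≥0∞, Measurable v →
      VolumeComparable K q (volume.withDensity v : Measure (E d)) → ∀ y r, 0 < r →
      ∫⁻ x in ball y r, v x ≠ 0 → ∫⁻ x in ball y r, v x ≠ ∞ →
      (∫⁻ x in ball y r, v x ^ (1 + τ)) * volume (ball y r) ^ τ ≤
        C * (∫⁻ x in ball y r, v x) ^ (1 + τ) := by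
  obtain ⟨a, β, C, ha, ha1, hβ, hdecay⟩ := VolumeComparable.exists_geometric_decay hd K q
  obtain ⟨τ, hτ, hτβ⟩ := exists_rpow_neg_mul_lt_one ha hβ
  have hA : 1 < a⁻¹ := (one_lt_inv₀ ha).2 ha1
  set A := a⁻¹ with hAdef
  refine ⟨τ, 1 + A ^ τ * (C * (1 - A ^ τ * β)⁻¹), hτ, fun v hv hcomp y r hr h0 htop => ?_⟩
  set b := ball y r
  set V := volume b
  set μ : Measure (E d) := volume.withDensity v
  have hV0 : V ≠ 0 := volume_ball_ne_zero y hr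
  have hV1 : V ≠ ∞ := volume_ball_ne_top y r
  have hμb : μ b = ∫⁻ x in b, v x := withDensity_apply _ measurableSet_ball
  rw [← hμb] at h0 htop ⊢
  have hμabs : μ ≪ volume := withDensity_absolutelyContinuous _ _
  set m := μ b / V with hm
  have hm0 : m ≠ 0 := ENNReal.div_ne_zero.2 ⟨h0, hV1⟩
  have hm1 : m ≠ ∞ := ENNReal.div_ne_top htop hV0
  have hmV : m * V = μ b := ENNReal.div_mul_cancel hV0 hV1
  -- By Chebyshev this level set fills at most the fraction `a ^ k` of the ball, so geometric decay
  -- applies.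
  have hlevel : ∀ k : ℕ, μ.restrict b {x | m * A ^ k < v x} ≤ C * β ^ k * μ b := by
    intro k
    have hmeas : MeasurableSet {x | m * A ^ k < v x} := measurableSet_lt measurable_const hv
    rw [Measure.restrict_apply hmeas]
    refine hdecay μ hμabs hcomp y r hr k _ inter_subset_right
      (hmeas.inter measurableSet_ball) ?_
    have hcheb : m * A ^ k * volume ({x | m * A ^ k < v x} ∩ b) ≤ m * V := by
      rw [hmV, hμb, ← Measure.restrict_apply hmeas]
      calc _ ≤ m * A ^ k * volume.restrict b {x | m * A ^ k ≤ v x} := by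
            gcongr
            exact fun h => h.le
        _ ≤ _ := mul_meas_ge_le_lintegral hv _
    rw [mul_assoc, ENNReal.mul_le_mul_iff_right hm0 hm1] at hcheb
    have haA : (a : ℝ≥0∞) ^ k * (A : ℝ≥0∞) ^ k = 1 := by
      rw [← mul_pow, ← ENNReal.coe_mul, hAdef, mul_inv_cancel₀ ha.ne', ENNReal.coe_one, one_pow]
    calc volume ({x | m * A ^ k < v x} ∩ b)
        = a ^ k * (A ^ k * volume ({x | m * A ^ k < v x} ∩ b)) := by
          rw [← mul_assoc, haA, one_mul]
      _ ≤ a ^ k * V := by gcongr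
  -- One power of `v` goes into the measure, so the layer cake sum needs only the `μ`-mass of the
  -- level sets.
  have hint : ∫⁻ x in b, v x ^ (1 + τ) = ∫⁻ x in b, v x ^ τ ∂μ := by
    rw [restrict_withDensity measurableSet_ball, lintegral_withDensity_eq_lintegral_mul _ hv
      (hv.pow_const _)]
    refine lintegral_congr fun x => ?_
    rw [Pi.mul_apply, ENNReal.rpow_add_of_nonneg _ _ zero_le_one hτ.le, ENNReal.rpow_one]
  have hfin : ∀ᵐ x ∂(μ.restrict b), v x ≠ ∞ := by
    have := ae_lt_top hv (μ := volume.restrict b) (hμb ▸ htop)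
    rw [ae_restrict_iff' measurableSet_ball] at this ⊢
    filter_upwards [hμabs.ae_le this] with x hx hxb using (hx hxb).ne
  have hsum : ∑' k : ℕ, (m * A ^ k) ^ τ * μ.restrict b {x | m * A ^ k < v x} ≤
      m ^ τ * μ b * (C * (1 - A ^ τ * β)⁻¹ : ℝ≥0) := by
    calc _ ≤ ∑' k : ℕ, (m * A ^ k) ^ τ * (C * β ^ k * μ b) := by
          gcongr with k
          exact hlevel k
      _ = ∑' k : ℕ, m ^ τ * μ b * C * ((A ^ τ * β : ℝ≥0) : ℝ≥0∞) ^ k := by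
        refine tsum_congr fun k => ?_
        rw [ENNReal.mul_rpow_of_nonneg _ _ hτ.le, ENNReal.coe_mul, mul_pow,
          ENNReal.coe_rpow_of_nonneg _ hτ.le, ← ENNReal.rpow_natCast, ← ENNReal.rpow_mul,
          mul_comm (k : ℝ), ENNReal.rpow_mul, ENNReal.rpow_natCast]
        ring
      _ = _ := by
        have hgeom : (((1 - A ^ τ * β)⁻¹ : ℝ≥0) : ℝ≥0∞) = (1 - ((A ^ τ * β : ℝ≥0) : ℝ≥0∞))⁻¹ := by
          rw [ENNReal.coe_inv (tsub_pos_of_lt hτβ).ne', ENNReal.coe_sub, ENNReal.coe_one]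
        rw [ENNReal.tsum_mul_left, ENNReal.tsum_geometric, ← hgeom, mul_assoc, ← ENNReal.coe_mul]
  have hmain : ∫⁻ x in b, v x ^ (1 + τ) ≤
      (1 + A ^ τ * (C * (1 - A ^ τ * β)⁻¹) : ℝ≥0) * (m ^ τ * μ b) := by
    rw [hint]
    calc _ ≤ m ^ τ * μ.restrict b univ +
          A ^ τ * ∑' k : ℕ, (m * A ^ k) ^ τ * μ.restrict b {x | m * A ^ k < v x} :=
          lintegral_rpow_le_add_tsum hτ.le hm0 hm1 hA hv.aemeasurable hfin
      _ ≤ m ^ τ * μ b + A ^ τ * (m ^ τ * μ b * (C * (1 - A ^ τ * β)⁻¹ : ℝ≥0)) := by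
        rw [Measure.restrict_apply_univ]
        gcongr
      _ = _ := by
        rw [ENNReal.coe_add, ENNReal.coe_one, ENNReal.coe_mul (A ^ τ),
          ← ENNReal.coe_rpow_of_nonneg _ hτ.le]
        ring
  calc _ ≤ (1 + A ^ τ * (C * (1 - A ^ τ * β)⁻¹) : ℝ≥0) * (m ^ τ * μ b) * V ^ τ := by gcongr
    _ = (1 + A ^ τ * (C * (1 - A ^ τ * β)⁻¹) : ℝ≥0) * ((m * V) ^ τ * μ b) := by
      rw [ENNReal.mul_rpow_of_nonneg _ _ hτ.le]; ring
    _ = _ := by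
      rw [hmV, ENNReal.rpow_add_of_nonneg _ _ zero_le_one hτ.le, ENNReal.rpow_one,
        mul_comm (μ b)]

/-- The `A_q` condition is open in `q`. -/
theorem IsNondegenerateAp.exists_lt (hd : 0 < d) {q : ℝ} (hq : 1 < q) (K : ℝ≥0) :
    ∃ (s : ℝ) (K' : ℝ≥0), 1 < s ∧ s < q ∧ ∀ w : E d → ℝ≥0∞, IsNondegenerateAp q K w →
      IsNondegenerateAp s K' w := by
  obtain ⟨τ, C, hτ, hRH⟩ := exists_reverse_holder hd (K ^ (1 / (q - 1))) (q / (q - 1))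
  have hq1 : 0 < q - 1 := by linarith
  have hτ1 : 0 < 1 + τ := by linarith
  -- Chosen so that the power `1 + τ` of the dual weight `w ^ (-(1 / (q - 1)))` is `w ^ (-(1 / (s -
  -- 1)))`: its reverse Hölder inequality is what A_s requires.
  set s := 1 + (q - 1) / (1 + τ) with hs
  have hs1 : 0 < s - 1 := by rw [hs]; simp only [add_sub_cancel_left]; positivity
  have hsτ : (1 + τ) * (s - 1) = q - 1 := by rw [hs]; field_simp; ring
  refine ⟨s, C ^ (s - 1) * K, by linarith, by nlinarith, fun w h => ⟨h.measurable, h.ne_zero,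
    h.ne_top, fun y r hr => ?_⟩⟩
  have hq' : 1 < q / (q - 1) := by rw [lt_div_iff₀ hq1]; linarith
  have hdual := h.dual hq
  have hR := hRH _ hdual.measurable (hdual.volumeComparable hq') y r hr (hdual.ne_zero y r hr)
    (hdual.ne_top y r hr)
  have hexp : -(1 / (q - 1)) * (1 + τ) = -(1 / (s - 1)) := by
    rw [← hsτ]; field_simp
  simp only [← ENNReal.rpow_mul, hexp] at hR
  set V := volume (ball y r)
  have hV0 : V ≠ 0 := volume_ball_ne_zero y hr
  have hV1 : V ≠ ∞ := volume_ball_ne_top y r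
  have hR' := ENNReal.rpow_le_rpow hR hs1.le
  rw [ENNReal.mul_rpow_of_nonneg _ _ hs1.le, ENNReal.mul_rpow_of_nonneg _ _ hs1.le,
    ← ENNReal.rpow_mul, ← ENNReal.rpow_mul, hsτ] at hR'
  have hVq0 : V ^ (τ * (s - 1)) ≠ 0 := by simp [ENNReal.rpow_eq_zero_iff, hV0, hV1]
  have hVq1 : V ^ (τ * (s - 1)) ≠ ∞ := ENNReal.rpow_ne_top_of_nonneg (by positivity) hV1
  rw [← ENNReal.mul_le_mul_iff_left hVq0 hVq1]
  calc _ = (∫⁻ x in ball y r, w x) * ((∫⁻ x in ball y r, w x ^ (-(1 / (s - 1)))) ^ (s - 1) *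
        V ^ (τ * (s - 1))) := by ring
    _ ≤ (∫⁻ x in ball y r, w x) *
        (C ^ (s - 1) * (∫⁻ x in ball y r, w x ^ (-(1 / (q - 1)))) ^ (q - 1)) := by gcongr
    _ = C ^ (s - 1) * ((∫⁻ x in ball y r, w x) *
        (∫⁻ x in ball y r, w x ^ (-(1 / (q - 1)))) ^ (q - 1)) := by ring
    _ ≤ C ^ (s - 1) * (K * V ^ q) := by
      gcongr _ * ?_
      exact h.le y r hr
    _ = _ := by
      have : q = s + τ * (s - 1) := by linarith
      rw [ENNReal.coe_mul, ENNReal.coe_rpow_of_nonneg _ hs1.le, mul_assoc, mul_assoc,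
        ← ENNReal.rpow_add _ _ hV0 hV1, ← this]

end ReverseHolder

/-! ### The good-λ inequality. -/

section GoodLambda

variable {d : ℕ}

theorem VolumeComparable.exists_small (hd : 0 < d) (K : ℝ≥0) (q : ℝ) {ε : ℝ≥0} (hε : 0 < ε) :
    ∃ δ : ℝ≥0, 0 < δ ∧ ∀ μ : Measure (E d), μ ≪ volume → VolumeComparable K q μ →
      ∀ y ρ, 0 < ρ → ∀ A ⊆ ball y ρ, MeasurableSet A →
        volume A ≤ δ * volume (ball y ρ) → μ A ≤ ε * μ (ball y ρ) := by
  obtain ⟨a, β, C, ha, -, hβ, h⟩ := VolumeComparable.exists_geometric_decay hd K q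
  have : ∃ k : ℕ, C * β ^ k ≤ ε := by
    rcases eq_or_ne C 0 with rfl | hC
    · exact ⟨0, by simp⟩
    · obtain ⟨k, hk⟩ := exists_pow_lt_of_lt_one (by positivity : 0 < ε / C) hβ
      refine ⟨k, ?_⟩
      rw [lt_div_iff₀ (by positivity)] at hk
      rw [mul_comm]; exact hk.le
  obtain ⟨k, hk⟩ := this
  refine ⟨a ^ k, by positivity, fun μ hμ hc y ρ hρ A hA hAm hvol => ?_⟩
  refine (h μ hμ hc y ρ hρ k A hA hAm (by exact_mod_cast hvol)).trans ?_
  gcongr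
  exact_mod_cast hk

/-- If averages of `g` over large balls around `x` are at most `t` and `g` is locally dominated by
a function with a small integral plus a function in a better weighted space, then the superlevel
set of the maximal function of `g` at height `A t` has small mass near `x`. -/
theorem exists_local_maxSet_le (hd : 0 < d) {q s : ℝ} (hq : 1 < q) (hqs : q < s) (K κ C₀ : ℝ≥0)
    (hκ : 0 < κ) :
    ∃ C A₀ : ℝ≥0, ∀ ε : ℝ≥0, 0 < ε → ∃ δ : ℝ≥0, 0 < δ ∧
      ∀ w : E d → ℝ≥0∞, IsNondegenerateAp q K w → ∀ A : ℝ≥0, A₀ ≤ A →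
      ∀ (x : E d) (R T : ℝ) (t : ℝ≥0∞) (g g₁ g₂ : E d → ℝ≥0∞), 0 < R → t ≠ 0 → t ≠ ∞ →
        AEMeasurable g₁ → AEMeasurable g₂ →
        (∀ᵐ z, z ∈ ball x (10 * R) → g z ≤ κ * (g₁ z + g₂ z)) →
        ∫⁻ z, g₁ z ≤ δ * t * volume (ball x R) →
        ∫⁻ z, g₂ z ^ s * w z ≤ C₀ * t ^ s * volume.withDensity w (ball x R) →
        (∀ r, 2 * R ≤ r → ∫⁻ z in ball x r, g z ≤ t * volume (ball x r)) →
        volume.withDensity w (ball x (6 * R) ∩ maxSet T g (A * t)) ≤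
          (ε + C * A ^ (-s) : ℝ≥0) * volume.withDensity w (ball x R) := by
  have hs : 1 < s := hq.trans hqs
  have hs0 : 0 < s := by linarith
  set W : ℝ≥0 := K * ((6 : ℝ) ^ d).toNNReal ^ s * K
  set D : ℝ≥0 := K * ((6 : ℝ) ^ d).toNNReal ^ q with hD
  -- The threshold `5 ^ d` excludes large balls below; `2 * κ` makes `A' = A / (2 * κ)` at least 1.
  refine ⟨W * C₀ * (2 * κ) ^ s, max (5 ^ d) (2 * κ), fun ε hε => ?_⟩
  obtain ⟨δ, hδ, hsmall⟩ := VolumeComparable.exists_small hd K q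
    (ε := ε / (D + 1)) (by positivity)
  refine ⟨δ / 6 ^ d, by positivity, fun w hw A hA x R T t g g₁ g₂ hR ht0 ht hg₁ hg₂ hg h₁ h₂ hbig => ?_⟩
  set μ : Measure (E d) := volume.withDensity w
  set A' : ℝ≥0 := A / (2 * κ) with hA'
  have hAA' : A = κ * (A' + A') := by rw [hA']; field_simp; ring
  have hA5 : 5 ^ d ≤ A := (le_max_left _ _).trans hA
  have hA'1 : 1 ≤ A' := (one_le_div (by positivity)).2 ((le_max_right _ _).trans hA)
  have hsub : ball x (6 * R) ∩ maxSet T g (A * t) ⊆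
      (ball x (6 * R) ∩ maxSet T g₁ (A' * t)) ∪ maxSet T g₂ (A' * t) := by
    rintro y ⟨hyx, hy⟩
    obtain ⟨c, r, hr, hrT, hlt, hyc⟩ := mem_maxSet.1 hy
    have hcx : dist c x < 6 * R + r := by
      rw [mem_ball] at hyx hyc
      linarith [dist_triangle_left c x y]
    -- If `r ≥ 2 * R`, the ball lies in the ball about `x` of radius `6 * R + 2 * r ≤ 5 * r`, where
    -- the average is at most `t`; so its own average is at most `5 ^ d * t ≤ A * t`.
    have hrR : r < 2 * R := by
      by_contra! hcon
      have hb : ball c r ⊆ ball x (6 * R + 2 * r) := ball_subset_ball' (by linarith)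
      refine absurd hlt (not_lt.2 ?_)
      calc ∫⁻ z in ball c r, g z ≤ ∫⁻ z in ball x (6 * R + 2 * r), g z :=
            lintegral_mono_set hb
        _ ≤ t * volume (ball x (6 * R + 2 * r)) := hbig _ (by linarith)
        _ ≤ t * (ENNReal.ofReal (5 ^ d) * volume (ball c r)) := by
          gcongr
          exact volume_ball_le_mul x c (by norm_num) hr (by linarith)
        _ ≤ t * (A * volume (ball c r)) := by
          gcongr
          rw [ENNReal.ofReal_pow (by norm_num), ENNReal.ofReal_ofNat]
          exact_mod_cast hA5
        _ = A * t * volume (ball c r) := by ring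
    have hb : ball c r ⊆ ball x (10 * R) := ball_subset_ball' (by linarith)
    by_contra hcon
    rw [mem_union, not_or] at hcon
    have hn : ∀ u : E d → ℝ≥0∞, y ∉ maxSet T u (A' * t) →
        ∫⁻ z in ball c r, u z ≤ A' * t * volume (ball c r) := fun u hu => by
      by_contra! hlt'
      exact hu (mem_maxSet.2 ⟨c, r, hr, hrT, hlt', hyc⟩)
    have hn₁ := hn g₁ fun h => hcon.1 ⟨hyx, h⟩
    have hn₂ := hn g₂ hcon.2
    refine absurd hlt (not_lt.2 ?_)
    calc ∫⁻ z in ball c r, g z ≤ ∫⁻ z in ball c r, κ * (g₁ z + g₂ z) := by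
          refine lintegral_mono_ae ?_
          rw [ae_restrict_iff' measurableSet_ball]
          filter_upwards [hg] with z hz hzb using hz (hb hzb)
      _ = κ * ((∫⁻ z in ball c r, g₁ z) + ∫⁻ z in ball c r, g₂ z) := by
        rw [lintegral_const_mul' _ _ ENNReal.coe_ne_top, lintegral_add_left' hg₁.restrict]
      _ ≤ κ * (A' * t * volume (ball c r) + A' * t * volume (ball c r)) := by gcongr
      _ = A * t * volume (ball c r) := by
        rw [hAA', ENNReal.coe_mul, ENNReal.coe_add]; ring
  -- Weak type (1, 1) makes the volume small and the A_∞ property transfers this to `μ`; division by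
  -- `D + 1` pays for doubling from `R` to `6 * R`.
  have hU₁ : μ (ball x (6 * R) ∩ maxSet T g₁ (A' * t)) ≤ ε * μ (ball x R) := by
    have hvol : volume (ball x (6 * R) ∩ maxSet T g₁ (A' * t)) ≤ δ * volume (ball x (6 * R)) := by
      rw [← ENNReal.mul_le_mul_iff_right ht0 ht]
      calc t * volume (ball x (6 * R) ∩ maxSet T g₁ (A' * t))
          ≤ A' * t * volume (maxSet T g₁ (A' * t)) := by
            gcongr
            · exact le_mul_of_one_le_left zero_le (by exact_mod_cast hA'1)
            · exact inter_subset_right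
        _ ≤ 6 ^ d * ∫⁻ z, g₁ z := mul_volume_maxSet_le T g₁ _
        _ ≤ 6 ^ d * ((δ / 6 ^ d : ℝ≥0) * t * volume (ball x R)) := by gcongr
        _ = (6 ^ d * (δ / 6 ^ d) : ℝ≥0) * t * volume (ball x R) := by push_cast; ring
        _ ≤ δ * t * volume (ball x (6 * R)) := by
          rw [mul_div_cancel₀ _ (by positivity)]
          gcongr
          linarith
        _ = _ := by ring
    calc _ ≤ (ε / (D + 1) : ℝ≥0) * μ (ball x (6 * R)) :=
          hsmall μ (withDensity_absolutelyContinuous _ _) (hw.volumeComparable hq) x _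
            (by positivity) _ inter_subset_left
            (measurableSet_ball.inter (isOpen_maxSet _ _ _).measurableSet) hvol
      _ ≤ (ε / (D + 1) : ℝ≥0) * (D * μ (ball x R)) := by
        gcongr
        exact (hw.volumeComparable hq).ball_le (by norm_num) hR (ball_subset_ball (by linarith))
      _ = (ε / (D + 1) * D : ℝ≥0) * μ (ball x R) := by rw [ENNReal.coe_mul _ D, mul_assoc]
      _ ≤ ε * μ (ball x R) := by
        gcongr
        rw [div_mul_eq_mul_div, div_le_iff₀ (by positivity)]
        gcongr
        simp
  -- Weak type (s, s): `w` is also an A_s weight because `q < s`.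
  have hU₂ : μ (maxSet T g₂ (A' * t)) ≤
      (W * C₀ * (2 * κ) ^ s * A ^ (-s) : ℝ≥0) * μ (ball x R) := by
    have hAt0 : (A' * t) ^ s ≠ 0 := by
      have : (A' : ℝ≥0∞) ≠ 0 := by
        rw [ENNReal.coe_ne_zero]; exact (zero_lt_one.trans_le hA'1).ne'
      have h3 : (A' * t) ≠ 0 := mul_ne_zero this ht0
      have h4 : (A' * t) ≠ ∞ := ENNReal.mul_ne_top ENNReal.coe_ne_top ht
      simp only [ne_eq, ENNReal.rpow_eq_zero_iff, h3, h4, false_and, or_self, not_false_eq_true]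
    have hAt1 : (A' * t) ^ s ≠ ∞ :=
      ENNReal.rpow_ne_top_of_nonneg hs0.le (ENNReal.mul_ne_top ENNReal.coe_ne_top ht)
    rw [← ENNReal.mul_le_mul_iff_right hAt0 hAt1]
    have hA0 : 0 < A := by
      rw [hAA']; have := zero_lt_one.trans_le hA'1; positivity
    have hconst : W * C₀ = A' ^ s * (W * C₀ * (2 * κ) ^ s * A ^ (-s)) := by
      rw [hA', NNReal.div_rpow, NNReal.rpow_neg]
      have : A ^ s ≠ 0 := (NNReal.rpow_pos hA0).ne'
      have : (2 * κ) ^ s ≠ 0 := (NNReal.rpow_pos (by positivity)).ne'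
      field_simp
    calc _ ≤ W * ∫⁻ z, g₂ z ^ s * w z :=
          (hw.mono hq hqs.le).rpow_mul_maxSet_le hs T hg₂ _
      _ ≤ W * (C₀ * t ^ s * μ (ball x R)) := by gcongr
      _ = (W * C₀ : ℝ≥0) * t ^ s * μ (ball x R) := by rw [ENNReal.coe_mul W]; ring
      _ = _ := by
        nth_rw 1 [hconst]
        rw [ENNReal.coe_mul (A' ^ s), ENNReal.mul_rpow_of_nonneg _ _ hs0.le,
          ENNReal.coe_rpow_of_nonneg _ hs0.le]
        ring
  calc _ ≤ μ ((ball x (6 * R) ∩ maxSet T g₁ (A' * t)) ∪ maxSet T g₂ (A' * t)) :=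
        measure_mono hsub
    _ ≤ _ := measure_union_le _ _
    _ ≤ ε * μ (ball x R) + (W * C₀ * (2 * κ) ^ s * A ^ (-s) : ℝ≥0) * μ (ball x R) := by
      gcongr
    _ = _ := by rw [ENNReal.coe_add, add_mul]

/-- The radii at which the centred average exceeds `t` are bounded by `ρ`, because of the total
integral. They exist: a ball containing `x` with average above `A * t` lies in the ball about `x` of
twice its radius, and `2 ^ d ≤ A`. Any such radius above half of the supremum will do. -/
theorem exists_stopping_radius {g : E d → ℝ≥0∞} {t : ℝ≥0∞} {A : ℝ≥0}
    (hA : 2 ^ d ≤ A) {x x₀ : E d} {T ρ : ℝ}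
    (hint : ∫⁻ z, g z ≤ t * volume (ball x₀ ρ)) (hx : x ∈ maxSet T g (A * t)) :
    ∃ R, 0 < R ∧ R < ρ ∧ t * volume (ball x R) < ∫⁻ z in ball x R, g z ∧
      ∀ r, 2 * R ≤ r → ∫⁻ z in ball x r, g z ≤ t * volume (ball x r) := by
  set S := {r : ℝ | 0 < r ∧ t * volume (ball x r) < ∫⁻ z in ball x r, g z} with hS
  have hbound : ∀ r ∈ S, r < ρ := by
    rintro r ⟨hr, hlt⟩
    by_contra! hcon
    refine absurd hlt (not_lt.2 ?_)
    calc ∫⁻ z in ball x r, g z ≤ ∫⁻ z, g z := setLIntegral_le_lintegral _ _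
      _ ≤ _ := hint
      _ = t * volume (ball x ρ) := by
        rw [Measure.addHaar_ball_center volume x₀, Measure.addHaar_ball_center volume x]
      _ ≤ _ := by gcongr
  have hbdd : BddAbove S := ⟨ρ, fun r hr => (hbound r hr).le⟩
  obtain ⟨c, r, hr, -, hlt, hxc⟩ := mem_maxSet.1 hx
  have hmem : 2 * r ∈ S := by
    refine ⟨by positivity, ?_⟩
    rw [mem_ball] at hxc
    calc t * volume (ball x (2 * r)) = ENNReal.ofReal (2 ^ d) * t * volume (ball c r) := by
          rw [volume_ball_mul x c two_pos hr]; ring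
      _ ≤ A * t * volume (ball c r) := by
        gcongr
        rw [ENNReal.ofReal_pow (by norm_num), ENNReal.ofReal_ofNat]
        exact_mod_cast hA
      _ < _ := hlt
      _ ≤ _ := lintegral_mono_set (ball_subset_ball' (by rw [dist_comm]; linarith))
  have hsup : 0 < sSup S := hmem.1.trans_le (le_csSup hbdd hmem)
  obtain ⟨R, hR, hRsup⟩ := exists_lt_of_lt_csSup ⟨_, hmem⟩ (half_lt_self hsup)
  refine ⟨R, hR.1, hbound R hR, hR.2, fun r hr => ?_⟩
  by_contra! hcon
  have := le_csSup hbdd (show r ∈ S from ⟨by linarith [hR.1], hcon⟩)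
  linarith

/-- Shift the centre from `x` towards `x₀` by the fraction `R / (2 * r₀)`. This makes doubling
available for balls cut by `ball x₀ r₀`. -/
theorem exists_ball_subset_ball_inter_ball {x x₀ : E d} {r₀ R : ℝ} (hR : 0 < R) (hRr : R ≤ r₀)
    (hx : x ∈ ball x₀ r₀) : ∃ c, ball c (R / 2) ⊆ ball x R ∩ ball x₀ r₀ := by
  have hr₀ : 0 < r₀ := hR.trans_le hRr
  set s := R / (2 * r₀) with hs
  have hs0 : 0 < s := by positivity
  have hsr : s * r₀ = R / 2 := by rw [hs]; field_simp
  have hs1 : s < 1 := by rw [hs, div_lt_one (by positivity)]; linarith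
  rw [mem_ball, dist_eq_norm] at hx
  refine ⟨x + s • (x₀ - x), subset_inter (ball_subset_ball' ?_) (ball_subset_ball' ?_)⟩
  · rw [dist_eq_norm, add_sub_cancel_left, norm_smul, Real.norm_of_nonneg hs0.le, norm_sub_rev]
    nlinarith
  · have : x + s • (x₀ - x) - x₀ = (1 - s) • (x - x₀) := by module
    rw [dist_eq_norm, this, norm_smul, Real.norm_of_nonneg (by linarith)]
    nlinarith

/-- The good-`λ` inequality. -/
theorem IsNondegenerateAp.good_lambda {q : ℝ} (hq : 1 < q) {K : ℝ≥0}
    {w : E d → ℝ≥0∞} (hw : IsNondegenerateAp q K w) {g h : E d → ℝ≥0∞} {t t' : ℝ≥0∞} {A ε : ℝ≥0}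
    (hA : 2 ^ d ≤ A) {x₀ : E d} {r₀ T ρ : ℝ} (hρr : ρ ≤ r₀) (hT : r₀ ≤ T)
    (hint : ∫⁻ z, g z ≤ t * volume (ball x₀ ρ))
    (hloc : ∀ x ∈ ball x₀ r₀, ∀ R, 0 < R → R < ρ →
      t * volume (ball x R) < ∫⁻ z in ball x R, g z →
      (∀ r, 2 * R ≤ r → ∫⁻ z in ball x r, g z ≤ t * volume (ball x r)) →
      ball x R ⊆ maxSet T h t' ∨
        volume.withDensity w (ball x (6 * R) ∩ maxSet T g (A * t)) ≤
          ε * volume.withDensity w (ball x R)) :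
    volume.withDensity w (ball x₀ r₀ ∩ maxSet T g (A * t)) ≤
      (K * ((12 : ℝ) ^ d).toNNReal ^ q : ℝ≥0) *
        (volume.withDensity w (ball x₀ r₀ ∩ maxSet T h t') +
          ε * volume.withDensity w (ball x₀ r₀ ∩ maxSet T g t)) := by
  set μ : Measure (E d) := volume.withDensity w
  set D : ℝ≥0 := K * ((12 : ℝ) ^ d).toNNReal ^ q
  let ι := {i : E d × ℝ // i.1 ∈ ball x₀ r₀ ∧ 0 < i.2 ∧ i.2 < ρ ∧
    t * volume (ball i.1 i.2) < (∫⁻ z in ball i.1 i.2, g z) ∧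
      (ball i.1 i.2 ⊆ maxSet T h t' ∨
        μ (ball i.1 (6 * i.2) ∩ maxSet T g (A * t)) ≤ ε * μ (ball i.1 i.2))}
  -- Both sides of the good-λ inequality are taken as measures, so only the comparison of one
  -- enlarged ball with its original remains.
  have hvit := measure_iUnion_ball_le (fun i : ι => i.1.1) (fun i : ι => i.1.2) ρ
    (fun i => i.2.2.1) (fun i => i.2.2.2.1.le) (μ.restrict (maxSet T g (A * t)))
    ((D : ℝ≥0∞) • (μ.restrict (ball x₀ r₀ ∩ maxSet T h t') +
      (ε : ℝ≥0∞) • μ.restrict (ball x₀ r₀ ∩ maxSet T g t))) (fun i => ?_)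
  · have hcov : ball x₀ r₀ ∩ maxSet T g (A * t) ⊆
        (⋃ i : ι, ball i.1.1 i.1.2) ∩ maxSet T g (A * t) := by
      rintro x ⟨hx, hxg⟩
      obtain ⟨R, hR, hRρ, h1, h2⟩ := exists_stopping_radius hA hint hxg
      exact ⟨mem_iUnion.2 ⟨⟨(x, R), hx, hR, hRρ, h1, hloc x hx R hR hRρ h1 h2⟩,
        mem_ball_self hR⟩, hxg⟩
    rw [Measure.restrict_apply (isOpen_iUnion fun _ => isOpen_ball).measurableSet] at hvit
    simpa only [Measure.smul_apply, Measure.add_apply, smul_eq_mul, Measure.restrict_apply_univ]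
      using (measure_mono hcov).trans hvit
  · obtain ⟨⟨x, R⟩, hx, hR, hRρ, h1, h2⟩ := i
    simp only at hx hR hRρ h1 h2 ⊢
    obtain ⟨c, hc⟩ := exists_ball_subset_ball_inter_ball hR (hRρ.le.trans hρr) hx
    have hdoub : μ (ball x (6 * R)) ≤ D * μ (ball x R ∩ ball x₀ r₀) := by
      have h12 : 6 * R = 12 * (R / 2) := by ring
      rw [h12]
      refine ((hw.volumeComparable hq).ball_le (y := c) (by norm_num) (by positivity) ?_).trans ?_
      · rw [← h12]
        exact hc.trans (inter_subset_left.trans (ball_subset_ball (by linarith)))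
      · gcongr
    have hg : ball x R ⊆ maxSet T g t :=
      ball_subset_maxSet hR (hRρ.le.trans (hρr.trans hT)) h1
    rw [Measure.restrict_apply measurableSet_ball, Measure.smul_apply, Measure.add_apply,
      Measure.smul_apply, smul_eq_mul, smul_eq_mul, Measure.restrict_apply measurableSet_ball,
      Measure.restrict_apply measurableSet_ball]
    rcases h2 with h2 | h2
    · calc _ ≤ μ (ball x (6 * R)) := measure_mono inter_subset_left
        _ ≤ D * μ (ball x R ∩ ball x₀ r₀) := hdoub
        _ ≤ D * μ (ball x R ∩ (ball x₀ r₀ ∩ maxSet T h t')) := by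
          gcongr _ * μ ?_
          exact fun z hz => ⟨hz.1, hz.2, h2 hz.1⟩
        _ ≤ _ := by gcongr; exact le_self_add
    · calc _ ≤ ε * μ (ball x R) := h2
        _ ≤ ε * μ (ball x (6 * R)) := by gcongr; linarith
        _ ≤ ε * (D * μ (ball x R ∩ ball x₀ r₀)) := by gcongr
        _ ≤ ε * (D * μ (ball x R ∩ (ball x₀ r₀ ∩ maxSet T g t))) := by
          gcongr _ * (_ * μ ?_)
          exact fun z hz => ⟨hz.1, hz.2, hg hz.1⟩
        _ = D * (ε * μ (ball x R ∩ (ball x₀ r₀ ∩ maxSet T g t))) := by ring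
        _ ≤ _ := by gcongr; exact le_add_self

end GoodLambda

/-! ### Summing over levels: the maximal theorem and absorption. -/

section Summation

variable {d : ℕ}

/-- The levels below `X` form a geometric progression of ratio `B = A ^ e > 1`, dominated by its
last term; `c = B / (B - 1)` solves `c + B = c * B`. -/
theorem exists_tsum_indicator_le {A : ℝ≥0} (hA : 1 < A) {e : ℝ} (he : 0 < e) :
    ∃ c : ℝ≥0, ∀ t X : ℝ≥0∞,
      ∑' k : ℕ, {Y : ℝ≥0∞ | t * A ^ k < Y}.indicator (fun _ => (t * A ^ k) ^ e) X ≤ c * X ^ e := by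
  classical
  set B : ℝ≥0 := A ^ e with hB
  have hB1 : 1 < B := NNReal.one_lt_rpow hA he
  obtain ⟨m, hm⟩ : ∃ m : ℝ≥0, m + 1 = B := ⟨B - 1, tsub_add_cancel_of_le hB1.le⟩
  have hm0 : 0 < m := by
    rw [← hm] at hB1; simpa using hB1
  set c : ℝ≥0 := B / m with hc
  have hcB : c + B = c * B := by
    rw [hc, ← hm]; field_simp; ring
  have hcB' : (c : ℝ≥0∞) + B = c * B := by exact_mod_cast hcB
  have hBpow : (A : ℝ≥0∞) ^ e = B := by rw [hB, ENNReal.coe_rpow_of_nonneg _ he.le]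
  refine ⟨c, fun t X => ?_⟩
  have hsucc : ∀ k : ℕ, (t * (A : ℝ≥0∞) ^ (k + 1)) ^ e = B * (t * A ^ k) ^ e := fun k => by
    rw [pow_succ, ← mul_assoc, ENNReal.mul_rpow_of_nonneg _ _ he.le, hBpow, mul_comm]
  have hfull : ∀ n : ℕ, ∑ k ∈ Finset.range (n + 1), (t * (A : ℝ≥0∞) ^ k) ^ e ≤
      c * (t * A ^ n) ^ e := by
    intro n
    induction n with
    | zero =>
      simp only [zero_add, Finset.range_one, Finset.sum_singleton]
      refine le_mul_of_one_le_left zero_le ?_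
      have : 1 ≤ c := by rw [hc, one_le_div hm0, ← hm]; simp
      exact_mod_cast this
    | succ n ih =>
      rw [Finset.sum_range_succ, hsucc]
      calc _ ≤ c * (t * (A : ℝ≥0∞) ^ n) ^ e + B * (t * (A : ℝ≥0∞) ^ n) ^ e := by gcongr
        _ = (c + B) * (t * (A : ℝ≥0∞) ^ n) ^ e := by rw [add_mul]
        _ = _ := by rw [hcB', mul_assoc]
  refine ENNReal.tsum_le_of_sum_range_le fun n => ?_
  induction n with
  | zero => simp
  | succ n ih =>
    by_cases hn : t * A ^ n < X
    · calc _ ≤ ∑ k ∈ Finset.range (n + 1), (t * (A : ℝ≥0∞) ^ k) ^ e := by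
            gcongr with k
            exact indicator_le_self' (fun _ _ => zero_le) _
        _ ≤ c * (t * A ^ n) ^ e := hfull n
        _ ≤ _ := by gcongr
    · rw [Finset.sum_range_succ, indicator_of_notMem (by exact hn), add_zero]
      exact ih

/-- Marcinkiewicz truncation: the values of `h` up to `t / 2` contribute at most `t / 2` to any
average. -/
theorem maxSet_subset_maxSet_indicator {T : ℝ} {h : E d → ℝ≥0∞} {t : ℝ≥0∞} (ht : t ≠ ∞) :
    maxSet T h t ⊆ maxSet T ({x | t < 2 * h x}.indicator h) (t / 2) := by
  intro x hx
  obtain ⟨y, r, hr, hrT, hlt, hxy⟩ := mem_maxSet.1 hx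
  refine mem_maxSet.2 ⟨y, r, hr, hrT, ?_, hxy⟩
  have hfin : t / 2 * volume (ball y r) ≠ ∞ :=
    ENNReal.mul_ne_top (ENNReal.div_ne_top ht two_ne_zero) (volume_ball_ne_top y r)
  have hle : ∫⁻ z in ball y r, h z ≤ t / 2 * volume (ball y r) +
      ∫⁻ z in ball y r, {x | t < 2 * h x}.indicator h z := by
    calc _ ≤ ∫⁻ z in ball y r, (t / 2 + {x | t < 2 * h x}.indicator h z) := by
          refine lintegral_mono fun z => ?_
          by_cases hz : t < 2 * h z
          · rw [indicator_of_mem (by exact hz)]; exact le_add_self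
          · refine le_add_of_le_left ?_
            rw [ENNReal.le_div_iff_mul_le (by simp) (by simp), mul_comm]
            exact not_lt.1 hz
      _ = _ := by rw [lintegral_add_left measurable_const, setLIntegral_const]
  have hlt' := hlt.trans_le hle
  rw [← ENNReal.add_halves t, add_mul] at hlt'
  simp only [ENNReal.add_halves] at hlt'
  exact (ENNReal.add_lt_add_iff_left hfin).1 hlt'

/-- Muckenhoupt's maximal theorem in discrete form. Openness gives an A_s condition with `s < q`;
the weak type (s, s) bound is applied to the truncation of `h` at each level `u`, and after
exchanging sum and integral the powers `u ^ (q - s)` over levels `u < 2 * h x` sum to a multiple of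
`h x ^ (q - s)`. -/
theorem exists_tsum_maxSet_le (hd : 0 < d) {q : ℝ} (hq : 1 < q) (K : ℝ≥0) {A : ℝ≥0} (hA : 1 < A) :
    ∃ C : ℝ≥0, ∀ w : E d → ℝ≥0∞, IsNondegenerateAp q K w → ∀ (T : ℝ) (h : E d → ℝ≥0∞),
      AEMeasurable h → ∀ t : ℝ≥0∞, t ≠ 0 → t ≠ ∞ →
      ∑' k : ℕ, (t * A ^ k) ^ q * volume.withDensity w (maxSet T h (t * A ^ k)) ≤
        C * ∫⁻ x, h x ^ q * w x := by
  obtain ⟨s, K', hs1, hsq, hopen⟩ := IsNondegenerateAp.exists_lt hd hq K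
  have hqs : 0 < q - s := by linarith
  have hs0 : 0 < s := by linarith
  obtain ⟨c, hc⟩ := exists_tsum_indicator_le hA hqs
  set W : ℝ≥0 := K' * ((6 : ℝ) ^ d).toNNReal ^ s * K' with hW
  refine ⟨2 ^ s * W * (c * 2 ^ (q - s)), fun w hw T h hh t ht0 ht => ?_⟩
  have hw' := hopen w hw
  set μ : Measure (E d) := volume.withDensity w
  have hind : ∀ u : ℝ≥0∞, AEMeasurable ({x | u < 2 * h x}.indicator h) := fun u =>
    hh.indicator₀ (nullMeasurableSet_lt aemeasurable_const (hh.const_mul 2))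
  have hterm : ∀ u : ℝ≥0∞, u ≠ 0 → u ≠ ∞ → u ^ q * μ (maxSet T h u) ≤
      (2 ^ s * W : ℝ≥0) *
        ∫⁻ x, u ^ (q - s) * ({x | u < 2 * h x}.indicator h x ^ s * w x) := by
    intro u hu0 hu
    have h1 : (u / 2) ^ s * μ (maxSet T h u) ≤
        W * ∫⁻ x, {x | u < 2 * h x}.indicator h x ^ s * w x :=
      (by gcongr; exact maxSet_subset_maxSet_indicator hu :
        _ ≤ (u / 2) ^ s * μ (maxSet T ({x | u < 2 * h x}.indicator h) (u / 2))).trans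
        (hw'.rpow_mul_maxSet_le hs1 T (hind u) _)
    have h2 : u ^ q = 2 ^ s * u ^ (q - s) * (u / 2) ^ s := by
      have hu2 : (2 : ℝ≥0∞) ^ s * (u / 2) ^ s = u ^ s := by
        rw [← ENNReal.mul_rpow_of_nonneg _ _ hs0.le, ENNReal.mul_div_cancel two_ne_zero
          ENNReal.ofNat_ne_top]
      rw [mul_right_comm, hu2, ← ENNReal.rpow_add _ _ hu0 hu]
      congr 1; ring
    calc u ^ q * μ (maxSet T h u)
        = 2 ^ s * u ^ (q - s) * ((u / 2) ^ s * μ (maxSet T h u)) := by rw [h2]; ring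
      _ ≤ 2 ^ s * u ^ (q - s) * (W * ∫⁻ x, {x | u < 2 * h x}.indicator h x ^ s * w x) := by
        gcongr
      _ = _ := by
        rw [lintegral_const_mul' _ _ (ENNReal.rpow_ne_top_of_nonneg hqs.le hu), ENNReal.coe_mul _ W,
          ENNReal.coe_rpow_of_nonneg _ hs0.le, ENNReal.coe_ofNat]
        ring
  have hAk : ∀ k : ℕ, t * (A : ℝ≥0∞) ^ k ≠ 0 := fun k =>
    mul_ne_zero ht0 (pow_ne_zero _ (by
      rw [ENNReal.coe_ne_zero]; exact (zero_lt_one.trans hA).ne'))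
  have hAk' : ∀ k : ℕ, t * (A : ℝ≥0∞) ^ k ≠ ∞ := fun k =>
    ENNReal.mul_ne_top ht (ENNReal.pow_ne_top ENNReal.coe_ne_top)
  calc _ ≤ ∑' k : ℕ, (2 ^ s * W : ℝ≥0) * ∫⁻ x, (t * A ^ k) ^ (q - s) *
        ({x | t * A ^ k < 2 * h x}.indicator h x ^ s * w x) :=
        ENNReal.tsum_le_tsum fun k => hterm _ (hAk k) (hAk' k)
    _ = (2 ^ s * W : ℝ≥0) * ∫⁻ x, ∑' k : ℕ, (t * A ^ k) ^ (q - s) *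
        ({x | t * A ^ k < 2 * h x}.indicator h x ^ s * w x) := by
      rw [ENNReal.tsum_mul_left, lintegral_tsum]
      exact fun k => (((hind _).pow_const s).mul hw.measurable.aemeasurable).const_mul _
    _ ≤ (2 ^ s * W : ℝ≥0) * ∫⁻ x, (c * 2 ^ (q - s) : ℝ≥0) * (h x ^ q * w x) := by
      gcongr with x
      calc _ ≤ ∑' k : ℕ, {Y : ℝ≥0∞ | t * A ^ k < Y}.indicator
            (fun _ => (t * A ^ k) ^ (q - s)) (2 * h x) * (h x ^ s * w x) := by
            refine ENNReal.tsum_le_tsum fun k => ?_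
            by_cases hx : t * A ^ k < 2 * h x
            · rw [indicator_of_mem (by exact hx), indicator_of_mem (by exact hx)]
            · rw [indicator_of_notMem (by exact hx), ENNReal.zero_rpow_of_pos hs0]
              simp
        _ ≤ c * (2 * h x) ^ (q - s) * (h x ^ s * w x) := by
          rw [ENNReal.tsum_mul_right]
          gcongr
          exact hc t _
        _ = _ := by
          have : h x ^ q = h x ^ (q - s) * h x ^ s := by
            rw [← ENNReal.rpow_add_of_nonneg _ _ hqs.le hs0.le]; congr 1; ring
          rw [this, ENNReal.mul_rpow_of_nonneg _ _ hqs.le, ENNReal.coe_mul c,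
            ENNReal.coe_rpow_of_nonneg _ hqs.le, ENNReal.coe_ofNat]
          ring
    _ = _ := by
      rw [lintegral_const_mul' _ _ ENNReal.coe_ne_top, ← mul_assoc, ← ENNReal.coe_mul]

/-- Absorption is done on partial sums, which are finite. Thus the weighted norm of `F` need not be
known to be finite beforehand. -/
theorem tsum_le_two_mul {a e : ℕ → ℝ≥0∞} (ha : ∀ k, a k ≠ ∞)
    (h : ∀ k, a (k + 1) ≤ 2⁻¹ * a k + e k) : ∑' k, a k ≤ 2 * (a 0 + ∑' k, e k) := by
  refine ENNReal.tsum_le_of_sum_range_le fun n => ?_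
  cases n with
  | zero => simp
  | succ n =>
    set S := ∑ k ∈ Finset.range (n + 1), a k with hS
    have hSfin : S ≠ ∞ := ENNReal.sum_ne_top.2 fun k _ => ha k
    have hle : S ≤ 2⁻¹ * S + (a 0 + ∑' k, e k) := by
      calc S = ∑ k ∈ Finset.range n, a (k + 1) + a 0 := Finset.sum_range_succ' _ _
        _ ≤ ∑ k ∈ Finset.range n, (2⁻¹ * a k + e k) + a 0 := by gcongr with k; exact h k
        _ = 2⁻¹ * ∑ k ∈ Finset.range n, a k + (a 0 + ∑ k ∈ Finset.range n, e k) := by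
          rw [Finset.sum_add_distrib, Finset.mul_sum]; ring
        _ ≤ _ := by
          gcongr
          · exact Finset.sum_le_sum_of_subset (Finset.range_mono n.le_succ)
          · exact ENNReal.sum_le_tsum _
    have hhalf : S = 2⁻¹ * S + 2⁻¹ * S := by
      rw [← add_mul, ENNReal.inv_two_add_inv_two, one_mul]
    nth_rw 1 [hhalf] at hle
    have := (ENNReal.add_le_add_iff_left (ENNReal.mul_ne_top (by simp) hSfin)).1 hle
    calc S = 2 * (2⁻¹ * S) := by
          rw [← mul_assoc, ENNReal.mul_inv_cancel two_ne_zero ENNReal.ofNat_ne_top, one_mul]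
      _ ≤ _ := by gcongr

/-- Integrating the good-`λ` inequality. -/
theorem exists_lintegral_rpow_le_of_good_lambda (hd : 0 < d) {q : ℝ} (hq : 1 < q) (K D : ℝ≥0)
    {A ε γ : ℝ≥0} (hA : 1 < A) (hγ : 0 < γ) (hε : A ^ q * D * ε ≤ 2⁻¹) :
    ∃ C : ℝ≥0, ∀ w : E d → ℝ≥0∞, IsNondegenerateAp q K w → ∀ (x₀ : E d) (r₀ T : ℝ)
      (g h : E d → ℝ≥0∞) (l : ℝ≥0∞), 0 < r₀ → 0 < T → AEMeasurable g → AEMeasurable h →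
      ∫⁻ x, g x ≠ ∞ → (∀ᵐ x, g x ≠ ∞) → l ≠ 0 → l ≠ ∞ →
      (∀ t, l ≤ t → t ≠ ∞ → volume.withDensity w (ball x₀ r₀ ∩ maxSet T g (A * t)) ≤
        D * (volume.withDensity w (ball x₀ r₀ ∩ maxSet T h (γ * t)) +
          ε * volume.withDensity w (ball x₀ r₀ ∩ maxSet T g t))) →
      ∫⁻ x in ball x₀ r₀, g x ^ q * w x ≤
        C * (l ^ q * volume.withDensity w (ball x₀ r₀) + ∫⁻ x, h x ^ q * w x) := by
  have hq0 : 0 < q := by linarith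
  obtain ⟨C₁, hC₁⟩ := exists_tsum_maxSet_le hd hq K hA
  set G : ℝ≥0 := A ^ q * D * (γ ^ q)⁻¹ * C₁ with hG
  refine ⟨1 + A ^ q * 2 * (1 + G), fun w hw x₀ r₀ T g h l hr₀ hT hg hh hgfin hgae hl0 hl hgl => ?_⟩
  set μ : Measure (E d) := volume.withDensity w with hμ
  set B := ball x₀ r₀
  have hμabs : μ ≪ volume := withDensity_absolutelyContinuous _ _
  have hμB : μ B ≠ ∞ := by
    rw [hμ, withDensity_apply _ measurableSet_ball]; exact hw.ne_top _ _ hr₀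
  have hAk : ∀ k : ℕ, l ≤ l * (A : ℝ≥0∞) ^ k := fun k =>
    le_mul_of_one_le_right zero_le (one_le_pow₀ (by exact_mod_cast hA.le))
  have hAk' : ∀ k : ℕ, l * (A : ℝ≥0∞) ^ k ≠ ∞ := fun k =>
    ENNReal.mul_ne_top hl (ENNReal.pow_ne_top ENNReal.coe_ne_top)
  set a : ℕ → ℝ≥0∞ := fun k => (l * A ^ k) ^ q * μ (B ∩ maxSet T g (l * A ^ k)) with ha
  set e : ℕ → ℝ≥0∞ := fun k =>
    (A ^ q * D : ℝ≥0) * ((l * A ^ k) ^ q * μ (B ∩ maxSet T h (γ * (l * A ^ k)))) with he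
  have hafin : ∀ k, a k ≠ ∞ := fun k => ENNReal.mul_ne_top
    (ENNReal.rpow_ne_top_of_nonneg hq0.le (hAk' k))
    ((measure_mono inter_subset_left).trans_lt hμB.lt_top).ne
  have hrec : ∀ k, a (k + 1) ≤ 2⁻¹ * a k + e k := by
    intro k
    have hsucc : l * (A : ℝ≥0∞) ^ (k + 1) = A * (l * A ^ k) := by ring
    have hεe : ((A ^ q * D * ε : ℝ≥0) : ℝ≥0∞) ≤ 2⁻¹ := by
      refine (ENNReal.coe_le_coe.2 hε).trans_eq ?_
      rw [ENNReal.coe_inv two_ne_zero, ENNReal.coe_ofNat]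
    simp only [ha, he, hsucc]
    calc _ ≤ (A * (l * A ^ k)) ^ q * (D * (μ (B ∩ maxSet T h (γ * (l * A ^ k))) +
          ε * μ (B ∩ maxSet T g (l * A ^ k)))) := by
          gcongr
          exact hgl _ (hAk k) (hAk' k)
      _ = (A ^ q * D * ε : ℝ≥0) * ((l * A ^ k) ^ q * μ (B ∩ maxSet T g (l * A ^ k))) +
          (A ^ q * D : ℝ≥0) * ((l * A ^ k) ^ q * μ (B ∩ maxSet T h (γ * (l * A ^ k)))) := by
        rw [ENNReal.mul_rpow_of_nonneg _ _ hq0.le, ENNReal.coe_mul _ ε, ENNReal.coe_mul _ D,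
          ENNReal.coe_rpow_of_nonneg _ hq0.le]
        ring
      _ ≤ _ := by gcongr
  have hsum_e : ∑' k, e k ≤ G * ∫⁻ x, h x ^ q * w x := by
    have hγ0 : (γ : ℝ≥0∞) ≠ 0 := by rw [ENNReal.coe_ne_zero]; exact hγ.ne'
    have hterm : ∀ k, e k ≤ (A ^ q * D * (γ ^ q)⁻¹ : ℝ≥0) *
        ((γ * l * A ^ k) ^ q * μ (maxSet T h (γ * l * A ^ k))) := fun k => by
      have hγq : (((γ ^ q)⁻¹ : ℝ≥0) : ℝ≥0∞) * γ ^ q = 1 := by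
        rw [← ENNReal.coe_rpow_of_nonneg _ hq0.le, ← ENNReal.coe_mul,
          inv_mul_cancel₀ (NNReal.rpow_pos hγ).ne', ENNReal.coe_one]
      simp only [he]
      rw [mul_assoc (γ : ℝ≥0∞), ENNReal.mul_rpow_of_nonneg (γ : ℝ≥0∞) _ hq0.le,
        ENNReal.coe_mul _ (γ ^ q)⁻¹]
      calc _ ≤ (A ^ q * D : ℝ≥0) * ((l * A ^ k) ^ q * μ (maxSet T h (γ * (l * A ^ k)))) := by
            gcongr
            exact inter_subset_right
        _ = (A ^ q * D : ℝ≥0) * ((((γ ^ q)⁻¹ : ℝ≥0) : ℝ≥0∞) * γ ^ q) *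
            ((l * A ^ k) ^ q * μ (maxSet T h (γ * (l * A ^ k)))) := by rw [hγq, mul_one]
        _ = _ := by ring
    calc _ ≤ ∑' k, (A ^ q * D * (γ ^ q)⁻¹ : ℝ≥0) *
          ((γ * l * A ^ k) ^ q * μ (maxSet T h (γ * l * A ^ k))) := ENNReal.tsum_le_tsum hterm
      _ ≤ (A ^ q * D * (γ ^ q)⁻¹ : ℝ≥0) * (C₁ * ∫⁻ x, h x ^ q * w x) := by
        rw [ENNReal.tsum_mul_left]
        gcongr
        exact hC₁ w hw T h hh _ (mul_ne_zero hγ0 hl0) (ENNReal.mul_ne_top ENNReal.coe_ne_top hl)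
      _ = _ := by rw [← mul_assoc, ← ENNReal.coe_mul]
  have ha0 : a 0 ≤ l ^ q * μ B := by
    simp only [ha, pow_zero, mul_one]
    gcongr
    exact inter_subset_left
  have hsum_a := tsum_le_two_mul hafin hrec
  have hint : ∫⁻ x in B, g x ^ q * w x = ∫⁻ x in B, g x ^ q ∂μ := by
    rw [hμ, restrict_withDensity measurableSet_ball, lintegral_withDensity_eq_lintegral_mul₀
      hw.measurable.aemeasurable (hg.restrict.pow_const _)]
    exact lintegral_congr fun x => mul_comm _ _
  -- Lebesgue differentiation returns from the maximal function to `g`.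
  have hlev : ∀ k : ℕ, μ.restrict B {x | l * A ^ k < g x} ≤ μ (B ∩ maxSet T g (l * A ^ k)) := by
    intro k
    rw [Measure.restrict_apply' measurableSet_ball]
    refine measure_mono_ae ?_
    filter_upwards [hμabs.ae_le (ae_mem_maxSet hd hT hg hgfin)] with x hx hxk
    exact ⟨hxk.2, hx _ hxk.1⟩
  rw [hint]
  clear_value G
  set I := ∫⁻ x, h x ^ q * w x with hI
  calc _ ≤ l ^ q * μ.restrict B univ +
        A ^ q * ∑' k : ℕ, (l * A ^ k) ^ q * μ.restrict B {x | l * A ^ k < g x} :=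
        lintegral_rpow_le_add_tsum hq0.le hl0 hl hA ((hg.mono_ac hμabs).restrict)
          (ae_restrict_of_ae (hμabs.ae_le hgae))
    _ ≤ l ^ q * μ B + A ^ q * (2 * (l ^ q * μ B + G * I)) := by
      rw [Measure.restrict_apply_univ]
      gcongr
      calc _ ≤ ∑' k, a k := ENNReal.tsum_le_tsum fun k => by
            simp only [ha]; exact mul_le_mul_right (hlev k) _
        _ ≤ _ := hsum_a
        _ ≤ _ := by gcongr
    _ ≤ l ^ q * μ B + I +
        A ^ q * (2 * ((1 + G) * (l ^ q * μ B + I))) := by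
      gcongr
      · exact le_self_add
      · rw [add_mul, mul_add, mul_add, one_mul, one_mul]
        calc _ ≤ (l ^ q * μ B + G * I) + (I + G * (l ^ q * μ B)) := le_self_add
          _ = _ := by ring
    _ = _ := by
      rw [ENNReal.coe_add, ENNReal.coe_mul, ENNReal.coe_mul, ENNReal.coe_add,
        ENNReal.coe_rpow_of_nonneg _ hq0.le]
      simp only [ENNReal.coe_one, ENNReal.coe_ofNat]
      ring

end Summation

/-! ### Averages over balls intersected with the domain. -/

section Domain

variable {d : ℕ}

theorem setLAverage_rpow_le_iff {S : Set (E d)} (h0 : volume S ≠ 0) (h1 : volume S ≠ ∞) {p : ℝ}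
    (hp : 0 < p) {u : E d → ℝ≥0∞} {b : ℝ≥0∞} :
    (⨍⁻ x in S, u x ∂volume) ^ (1 / p) ≤ b ↔ ∫⁻ x in S, u x ≤ b ^ p * volume S := by
  rw [one_div, ENNReal.rpow_inv_le_iff hp, setLAverage_eq,
    ENNReal.div_le_iff h0 h1]

theorem setLIntegral_indicator_inter {b D Ω : Set (E d)} (hD : MeasurableSet (D ∩ Ω)) (hb : b ⊆ D)
    (u : E d → ℝ≥0∞) : ∫⁻ x in b, (D ∩ Ω).indicator u x = ∫⁻ x in b ∩ Ω, u x := by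
  rw [setLIntegral_indicator hD]
  congr 2
  ext x
  simp only [mem_inter_iff]
  exact ⟨fun h => ⟨h.2, h.1.2⟩, fun h => ⟨⟨hb h.1, h.2⟩, h.1⟩⟩

/-- A small ball meeting `Ω` is contained in a comparable ball which is either well inside `Ω` or
centred on the boundary. -/
theorem exists_interior_or_boundary_ball {Ω : Set (E d)} {x x₀ : E d} {R r₀ : ℝ} (hR : 0 < R)
    (hRr : 100 * R ≤ r₀) (hx : x ∈ ball x₀ r₀) (hne : (ball x R ∩ Ω).Nonempty) :
    ∃ (y : E d) (r : ℝ), 5 * R ≤ r ∧ r ≤ 25 * R ∧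
      (y ∈ ball x₀ (2 * r₀) ∩ frontier Ω ∨ ball y (4 * r) ⊆ ball x₀ (2 * r₀) ∩ Ω) ∧
      y ∈ closure Ω ∧ ball x R ⊆ ball y r ∧ ball x (10 * R) ⊆ ball y (2 * r) ∧
      ball y (8 * r) ⊆ ball x₀ (4 * r₀) ∧ ball y (8 * r) ⊆ ball x (48 * r) ∧
      ball y r ⊆ ball x (45 * R) := by
  rw [mem_ball] at hx
  -- Inside, keep the centre and take `r = 5 * R`, so that `4 * r = 20 * R`. Otherwise a frontier
  -- point lies within `20 * R` of `x`, and `r = 25 * R` about it suffices.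
  by_cases hin : ball x (20 * R) ⊆ Ω
  · refine ⟨x, 5 * R, le_rfl, by linarith, Or.inr (subset_inter ?_ ?_), ?_, ?_, ?_, ?_, ?_, ?_⟩
    · exact ball_subset_ball' (by linarith)
    · exact (ball_subset_ball (by linarith)).trans hin
    · exact subset_closure (hin (mem_ball_self (by positivity)))
    · exact ball_subset_ball (by linarith)
    · exact ball_subset_ball (by linarith)
    · exact ball_subset_ball' (by linarith)
    · exact ball_subset_ball (by linarith)
    · exact ball_subset_ball (by linarith)
  · have h1 : (ball x (20 * R) ∩ Ω).Nonempty :=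
      hne.mono (inter_subset_inter_left _ (ball_subset_ball (by linarith)))
    have h2 : (ball x (20 * R) ∩ Ωᶜ).Nonempty := by
      obtain ⟨z, hz, hz'⟩ := not_subset.1 hin
      exact ⟨z, hz, hz'⟩
    obtain ⟨z, hzx, hz⟩ := inter_frontier_nonempty_of_isPreconnected
      (convex_ball x (20 * R)).isPreconnected h1 h2
    rw [mem_ball] at hzx
    have hxz : dist x z < 20 * R := by rwa [dist_comm]
    have hzx₀ := dist_triangle z x x₀
    refine ⟨z, 25 * R, by linarith, le_rfl, Or.inl ⟨?_, hz⟩, frontier_subset_closure hz,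
      ?_, ?_, ?_, ?_, ?_⟩
    · rw [mem_ball]; linarith
    · exact ball_subset_ball' (by linarith)
    · exact ball_subset_ball' (by linarith)
    · exact ball_subset_ball' (by linarith)
    · exact ball_subset_ball' (by linarith)
    · exact ball_subset_ball' (by linarith)

theorem pos_and_le_of_ball_subset_ball (hd : 0 < d) {y z x₀ : E d} {r R : ℝ} (hz : z ∈ ball y r)
    (h : ball y r ⊆ ball x₀ R) : 0 < r ∧ r ≤ R := by
  have hr : 0 < r := pos_of_mem_ball hz
  exact ⟨hr, radius_le_of_volume_ball_le hd hr (pos_of_mem_ball (h hz)) (measure_mono h)⟩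

theorem volume_ball_inter_ne_zero {Ω : Set (E d)} {θ : ℝ≥0} (hθ : 0 < θ) {y : E d} {r : ℝ}
    (hr : 0 < r) (hθV : θ * volume (ball y r) ≤ volume (ball y r ∩ Ω)) :
    volume (ball y r ∩ Ω) ≠ 0 := fun h0 => by
  rw [h0, nonpos_iff_eq_zero, mul_eq_zero] at hθV
  exact hθV.elim (ENNReal.coe_ne_zero.2 hθ.ne') (volume_ball_ne_zero y hr)

theorem lpAvg_ball_inter_le {Ω : Set (E d)} (hΩ : IsOpen Ω) {θ : ℝ≥0} (hθ : 0 < θ) {x₀ : E d}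
    {r₀ : ℝ} (hdens : ∀ y ∈ closure Ω, ∀ r, 0 < r → r ≤ 4 * r₀ →
      θ * volume (ball y r) ≤ volume (ball y r ∩ Ω)) {p₀ : ℝ}
    (hp₀ : 0 < p₀) {f : E d → ℝ} {y : E d} {r : ℝ}
    (hy : y ∈ closure Ω) (hr : 0 < r) (hr' : r ≤ 4 * r₀) (hsub : ball y r ⊆ ball x₀ (4 * r₀))
    {u : ℝ≥0∞}
    (hu : ∫⁻ z in ball y r, (ball x₀ (4 * r₀) ∩ Ω).indicator (fun x => ‖f x‖ₑ ^ p₀) z ≤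
      u * volume (ball y r)) :
    lpAvg p₀ (ball y r ∩ Ω) f ≤ (u * (θ⁻¹ : ℝ≥0)) ^ (1 / p₀) := by
  have hθV := hdens y hy r hr hr'
  have h0 := volume_ball_inter_ne_zero hθ hr hθV
  have h1 : volume (ball y r ∩ Ω) ≠ ∞ :=
    ((measure_mono inter_subset_left).trans_lt measure_ball_lt_top).ne
  rw [lpAvg, setLAverage_rpow_le_iff h0 h1 hp₀, ← ENNReal.rpow_mul,
    one_div_mul_cancel hp₀.ne', ENNReal.rpow_one,
    ← setLIntegral_indicator_inter (measurableSet_ball.inter hΩ.measurableSet) hsub]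
  refine hu.trans ?_
  calc u * volume (ball y r) = u * ((θ⁻¹ : ℝ≥0) * (θ * volume (ball y r))) := by
        rw [← mul_assoc ((θ⁻¹ : ℝ≥0) : ℝ≥0∞), ← ENNReal.coe_mul, inv_mul_cancel₀ hθ.ne',
          ENNReal.coe_one, one_mul]
    _ ≤ u * ((θ⁻¹ : ℝ≥0) * volume (ball y r ∩ Ω)) := by gcongr
    _ = _ := by ring

/-- Every ball in the supremum contains `ball x R` and has radius at most `4 * r₀`; if one of them
has average above `u`, it places all of `ball x R` in the superlevel set. Otherwise measure density
passes from averages over balls to averages over their parts in `Ω`. -/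
theorem supLpAvg_le_or_subset_maxSet (hd : 0 < d) {Ω : Set (E d)} (hΩ : IsOpen Ω) {θ : ℝ≥0} (hθ : 0 < θ) {x₀ : E d}
    {r₀ : ℝ} (hdens : ∀ y ∈ closure Ω, ∀ r, 0 < r → r ≤ 4 * r₀ →
      θ * volume (ball y r) ≤ volume (ball y r ∩ Ω)) {p₀ : ℝ}
    (hp₀ : 0 < p₀) {f : E d → ℝ} {x y : E d} {R r : ℝ} (hR : 0 < R) (hxy : ball x R ⊆ ball y r) (u : ℝ≥0∞) :
    ball x R ⊆ maxSet (4 * r₀) ((ball x₀ (4 * r₀) ∩ Ω).indicator fun x => ‖f x‖ₑ ^ p₀) u ∨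
      supLpAvg p₀ Ω (ball y r) (ball x₀ (4 * r₀)) f ≤ (u * (θ⁻¹ : ℝ≥0)) ^ (1 / p₀) := by
  rw [or_iff_not_imp_left]
  intro hn
  refine iSup_le fun z => iSup_le fun s => iSup_le fun hzs => ?_
  obtain ⟨hz, hyz, hzD⟩ := hzs
  obtain ⟨hs, hs'⟩ := pos_and_le_of_ball_subset_ball hd
    (hyz (hxy (mem_ball_self hR))) hzD
  refine lpAvg_ball_inter_le hΩ hθ hdens hp₀ hz hs hs' hzD ?_
  by_contra! hcon
  exact hn (hxy.trans (hyz.trans (ball_subset_maxSet hs hs' hcon)))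

end Domain

/-! ### The local decomposition at a stopping ball. -/

section LocalStep

variable {d : ℕ}

theorem ENNReal.add_rpow_le_two_rpow_mul {p : ℝ} (hp : 0 < p) (a b : ℝ≥0∞) :
    (a + b) ^ p ≤ 2 ^ p * (a ^ p + b ^ p) := by
  calc (a + b) ^ p ≤ (2 * max a b) ^ p := by
        gcongr
        rw [two_mul]
        exact add_le_add (le_max_left _ _) (le_max_right _ _)
    _ = 2 ^ p * max a b ^ p := ENNReal.mul_rpow_of_nonneg _ _ hp.le
    _ ≤ 2 ^ p * (a ^ p + b ^ p) := by
      gcongr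
      rcases le_total a b with h | h
      · rw [max_eq_right h]; exact le_add_self
      · rw [max_eq_left h]; exact le_self_add

/-- From the decomposition of `F` on suitable balls to a majorant of `|F| ^ p₀` near a point at
which the averages of `|F| ^ p₀` are controlled. -/
theorem IsNondegenerateAp.exists_majorant (hd : 0 < d) {p₀ p₁ q : ℝ} (hp₀ : 0 < p₀) (hp₁ : 0 < p₁)
    (hq : 1 < q) {K : ℝ≥0} {w : E d → ℝ≥0∞} (hw : IsNondegenerateAp q K w) {ω : E d → ℝ}
    (hω : (fun x => ENNReal.ofReal (ω x)) =ᵐ[volume] w)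
    {Ω : Set (E d)} (hΩ : IsOpen Ω) {θ : ℝ≥0} (hθ : 0 < θ) {x₀ : E d} {r₀ : ℝ}
    (hdens : ∀ y ∈ closure Ω, ∀ r, 0 < r → r ≤ 4 * r₀ →
      θ * volume (ball y r) ≤ volume (ball y r ∩ Ω))
    {N₁ N₂ η γ δ : ℝ≥0} (hγ : γ ≤ 1)
    (hδ : (N₁ * γ ^ (1 / p₀) + η) ^ p₀ * (6 ^ d * θ⁻¹) * 50 ^ d ≤ δ)
    {F f : E d → ℝ} {x : E d} (hx : x ∈ ball x₀ r₀) {R : ℝ} (hR : 0 < R) (hRr : 100 * R ≤ r₀)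
    {t : ℝ≥0∞}
    (hne : ∫⁻ z in ball x R,
      (ball x₀ (4 * r₀) ∩ Ω).indicator (fun x => ‖F x‖ₑ ^ p₀) z ≠ 0)
    (hbig : ∀ r, 2 * R ≤ r → ∫⁻ z in ball x r,
      (ball x₀ (4 * r₀) ∩ Ω).indicator (fun x => ‖F x‖ₑ ^ p₀) z ≤ t * volume (ball x r))
    (hdecomp : ∀ (y₀ : E d) (r : ℝ), 0 < r → r ≤ 25 * R →
      ball y₀ (8 * r) ⊆ ball x₀ (4 * r₀) →
      (y₀ ∈ ball x₀ (2 * r₀) ∩ frontier Ω ∨ ball y₀ (4 * r) ⊆ ball x₀ (2 * r₀) ∩ Ω) →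
      ∃ F_B R_B : E d → ℝ,
        AEMeasurable F_B (volume.restrict (ball y₀ (2 * r) ∩ Ω)) ∧
        AEMeasurable R_B (volume.restrict (ball y₀ (2 * r) ∩ Ω)) ∧
        (∀ᵐ x ∂(volume.restrict (ball y₀ (2 * r) ∩ Ω)), |F x| ≤ |F_B x| + |R_B x|) ∧
        lpAvg p₀ (ball y₀ (2 * r) ∩ Ω) F_B ≤
          N₁ * supLpAvg p₀ Ω (ball y₀ r) (ball x₀ (4 * r₀)) f +
            η * lpAvg p₀ (ball y₀ (8 * r) ∩ Ω) F ∧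
        weightedLpAvg p₁ ω (ball y₀ (2 * r) ∩ Ω) R_B ≤
          N₂ * (lpAvg p₀ (ball y₀ (8 * r) ∩ Ω) F +
              supLpAvg p₀ Ω (ball y₀ r) (ball x₀ (4 * r₀)) f) *
            (⨍⁻ x in ball y₀ r, ENNReal.ofReal (ω x) ∂volume) ^ (1 / p₁)) :
    ball x R ⊆ maxSet (4 * r₀)
      ((ball x₀ (4 * r₀) ∩ Ω).indicator fun x => ‖f x‖ₑ ^ p₀) (γ * t) ∨
    ∃ g₁ g₂ : E d → ℝ≥0∞, AEMeasurable g₁ ∧ AEMeasurable g₂ ∧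
      (∀ᵐ z, z ∈ ball x (10 * R) →
        (ball x₀ (4 * r₀) ∩ Ω).indicator (fun x => ‖F x‖ₑ ^ p₀) z ≤
          (2 ^ p₀ : ℝ≥0) * (g₁ z + g₂ z)) ∧
      ∫⁻ z, g₁ z ≤ δ * t * volume (ball x R) ∧
      ∫⁻ z, g₂ z ^ (p₁ / p₀) * w z ≤
        ((2 * N₂) ^ p₁ * (6 ^ d * θ⁻¹) ^ (p₁ / p₀) * 2 ^ d * (K * ((45 : ℝ) ^ d).toNNReal ^ q) :
          ℝ≥0) * t ^ (p₁ / p₀) * volume.withDensity w (ball x R) := by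
  have hneΩ : (ball x R ∩ Ω).Nonempty := by
    by_contra hemp
    refine hne ?_
    refine (setLIntegral_congr_fun (g := fun _ => 0) measurableSet_ball fun z hz => ?_).trans
      lintegral_zero
    exact indicator_of_notMem (fun h => hemp ⟨z, hz, h.2⟩) _
  obtain ⟨y, r, hr5, hr25, hcase, hy, hxy, hxy2, h8, h8x, hyx⟩ :=
    exists_interior_or_boundary_ball hR hRr hx hneΩ
  have hr : 0 < r := by linarith
  set P : ℝ≥0 := 6 ^ d * θ⁻¹ with hP
  set g : E d → ℝ≥0∞ := (ball x₀ (4 * r₀) ∩ Ω).indicator fun x => ‖F x‖ₑ ^ p₀ with hg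
  -- A common scale: the average of `F` on the eightfold ball is at most `L`, and the supremum for
  -- `f` at most `γ ^ (1 / p₀) * L`.
  set L : ℝ≥0∞ := (t * P) ^ (1 / p₀) with hL
  have hLp : L ^ p₀ = t * P := by
    rw [hL, ← ENNReal.rpow_mul, one_div_mul_cancel hp₀.ne', ENNReal.rpow_one]
  have hθP : θ⁻¹ ≤ P := le_mul_of_one_le_left (by positivity) (one_le_pow₀ (by norm_num))
  rcases supLpAvg_le_or_subset_maxSet hd hΩ hθ hdens hp₀ (f := f) hR hxy (γ * t) with hsup | hsup
  · exact Or.inl hsup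
  right
  have hsup' : supLpAvg p₀ Ω (ball y r) (ball x₀ (4 * r₀)) f ≤ γ ^ (1 / p₀) * L := by
    refine hsup.trans ?_
    rw [hL, ← ENNReal.mul_rpow_of_nonneg _ _ (by positivity), mul_assoc]
    gcongr
  -- The stopping bound is used on `ball x (48 * r)`, six times as wide as `ball y (8 * r)`; this is
  -- the factor `6 ^ d` in `P`.
  have hF : lpAvg p₀ (ball y (8 * r) ∩ Ω) F ≤ L := by
    have := lpAvg_ball_inter_le hΩ hθ hdens hp₀ (f := F) hy (r := 8 * r) (by positivity)
      (by linarith) h8 (u := 6 ^ d * t) (by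
        calc _ ≤ ∫⁻ z in ball x (48 * r), g z := lintegral_mono_set h8x
          _ ≤ t * volume (ball x (48 * r)) := hbig _ (by linarith)
          _ ≤ t * (ENNReal.ofReal (6 ^ d) * volume (ball y (8 * r))) := by
            gcongr
            exact volume_ball_le_mul x y (by norm_num) (by positivity) (by linarith)
          _ = _ := by
            rw [ENNReal.ofReal_pow (by norm_num), ENNReal.ofReal_ofNat]; ring)
    refine this.trans_eq ?_
    rw [hL, hP]
    push_cast
    congr 1
    ring
  obtain ⟨F_B, R_B, hFm, hRm, hdom, hFB, hRB⟩ := hdecomp y r hr hr25 h8 hcase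
  set S := ball y (2 * r) ∩ Ω with hS
  have hSm : MeasurableSet S := measurableSet_ball.inter hΩ.measurableSet
  have hS0 : volume S ≠ 0 :=
    volume_ball_inter_ne_zero hθ (by positivity) (hdens y hy (2 * r) (by positivity) (by linarith))
  have hS1 : volume S ≠ ∞ := ((measure_mono inter_subset_left).trans_lt measure_ball_lt_top).ne
  have hSle : volume S ≤ volume (ball y (2 * r)) := measure_mono inter_subset_left
  refine ⟨S.indicator fun z => ‖F_B z‖ₑ ^ p₀, S.indicator fun z => ‖R_B z‖ₑ ^ p₀,
    (aemeasurable_indicator_iff hSm).2 (hFm.enorm.pow_const _),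
    (aemeasurable_indicator_iff hSm).2 (hRm.enorm.pow_const _), ?_, ?_, ?_⟩
  · rw [ae_restrict_iff' hSm] at hdom
    filter_upwards [hdom] with z hz hzx
    by_cases hzΩ : z ∈ ball x₀ (4 * r₀) ∩ Ω
    · have hzS : z ∈ S := ⟨hxy2 hzx, hzΩ.2⟩
      rw [hg, indicator_of_mem hzΩ, indicator_of_mem hzS, indicator_of_mem hzS]
      have hz' : ‖F z‖ₑ ≤ ‖F_B z‖ₑ + ‖R_B z‖ₑ := by
        simp only [Real.enorm_eq_ofReal_abs]
        rw [← ENNReal.ofReal_add (abs_nonneg _) (abs_nonneg _)]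
        exact ENNReal.ofReal_le_ofReal (hz hzS)
      calc _ ≤ (‖F_B z‖ₑ + ‖R_B z‖ₑ) ^ p₀ := by gcongr
        _ ≤ _ := ENNReal.add_rpow_le_two_rpow_mul hp₀ _ _
        _ = _ := by rw [ENNReal.coe_rpow_of_nonneg _ hp₀.le, ENNReal.coe_ofNat]
    · rw [hg, indicator_of_notMem hzΩ]
      exact zero_le
  · rw [lintegral_indicator hSm]
    have hFB' : lpAvg p₀ S F_B ≤ (N₁ * γ ^ (1 / p₀) + η : ℝ≥0) * L := by
      refine hFB.trans ?_
      calc _ ≤ N₁ * (γ ^ (1 / p₀) * L) + η * L := by gcongr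
        _ = _ := by
          rw [ENNReal.coe_add, ENNReal.coe_mul, ENNReal.coe_rpow_of_nonneg _ (by positivity)]
          ring
    rw [lpAvg, setLAverage_rpow_le_iff hS0 hS1 hp₀] at hFB'
    calc _ ≤ _ := hFB'
      _ ≤ ((N₁ * γ ^ (1 / p₀) + η : ℝ≥0) * L) ^ p₀ * (50 ^ d * volume (ball x R)) := by
        gcongr
        refine hSle.trans ((volume_ball_le_mul y x (k := 50) (by norm_num) hR
          (by linarith)).trans_eq ?_)
        rw [ENNReal.ofReal_pow (by norm_num), ENNReal.ofReal_ofNat]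
      _ = ((N₁ * γ ^ (1 / p₀) + η) ^ p₀ * P * 50 ^ d : ℝ≥0) * t * volume (ball x R) := by
        rw [ENNReal.mul_rpow_of_nonneg _ _ hp₀.le, hLp, ENNReal.coe_mul _ (50 ^ d), ENNReal.coe_mul _ P,
          ENNReal.coe_rpow_of_nonneg _ hp₀.le, ENNReal.coe_pow, ENNReal.coe_ofNat]
        ring
      _ ≤ _ := by gcongr
  · set s := p₁ / p₀ with hs
    have hs0 : 0 < s := by positivity
    set μ : Measure (E d) := volume.withDensity w with hμ
    have hV0 : volume (ball y r) ≠ 0 := volume_ball_ne_zero y hr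
    have hV1 : volume (ball y r) ≠ ∞ := volume_ball_ne_top y r
    have hint : ∫⁻ z, S.indicator (fun z => ‖R_B z‖ₑ ^ p₀) z ^ s * w z =
        ∫⁻ z in S, ‖R_B z‖ₑ ^ p₁ * ENNReal.ofReal (ω z) := by
      rw [← lintegral_indicator hSm]
      refine lintegral_congr_ae ?_
      filter_upwards [hω] with z hz
      by_cases hzS : z ∈ S
      · rw [indicator_of_mem hzS, indicator_of_mem hzS, ← ENNReal.rpow_mul, hs,
          mul_div_cancel₀ _ hp₀.ne', hz]
      · rw [indicator_of_notMem hzS, indicator_of_notMem hzS, ENNReal.zero_rpow_of_pos hs0,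
          zero_mul]
    have havg : (⨍⁻ x in ball y r, ENNReal.ofReal (ω x) ∂volume) * volume (ball y r) =
        μ (ball y r) := by
      rw [setLAverage_eq, ENNReal.div_mul_cancel hV0 hV1, hμ,
        withDensity_apply _ measurableSet_ball]
      exact lintegral_congr_ae (ae_restrict_of_ae hω)
    set m := ⨍⁻ x in ball y r, ENNReal.ofReal (ω x) ∂volume
    have hRB' : weightedLpAvg p₁ ω S R_B ≤ (2 * N₂ : ℝ≥0) * L * m ^ (1 / p₁) := by
      refine hRB.trans ?_
      calc _ ≤ N₂ * (L + 1 * L) * m ^ (1 / p₁) := by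
            gcongr
            refine hsup'.trans ?_
            gcongr
            rw [← ENNReal.coe_rpow_of_nonneg _ (by positivity)]
            exact_mod_cast NNReal.rpow_le_one hγ (by positivity)
        _ = _ := by rw [ENNReal.coe_mul, ENNReal.coe_ofNat]; ring
    rw [weightedLpAvg, setLAverage_rpow_le_iff hS0 hS1 hp₁] at hRB'
    have hLp₁ : L ^ p₁ = t ^ s * P ^ s := by
      rw [← ENNReal.mul_rpow_of_nonneg _ _ hs0.le, ← hLp, ← ENNReal.rpow_mul L, hs,
        mul_div_cancel₀ _ hp₀.ne']
    have hm : (m ^ (1 / p₁)) ^ p₁ = m := by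
      rw [← ENNReal.rpow_mul, one_div_mul_cancel hp₁.ne', ENNReal.rpow_one]
    have hμy : μ (ball y r) ≤ (K * ((45 : ℝ) ^ d).toNNReal ^ q : ℝ≥0) * μ (ball x R) :=
      (measure_mono hyx).trans ((hw.volumeComparable hq).ball_le (by norm_num) hR
        (ball_subset_ball (by linarith)))
    rw [hint]
    calc _ ≤ _ := hRB'
      _ ≤ ((2 * N₂ : ℝ≥0) * L * m ^ (1 / p₁)) ^ p₁ * (2 ^ d * volume (ball y r)) := by
        gcongr
        refine hSle.trans_eq ?_
        rw [volume_ball_mul y y two_pos hr, ENNReal.ofReal_pow (by norm_num), ENNReal.ofReal_ofNat]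
      _ = (2 * N₂ : ℝ≥0) ^ p₁ * (t ^ s * P ^ s) * 2 ^ d * (m * volume (ball y r)) := by
        rw [ENNReal.mul_rpow_of_nonneg _ _ hp₁.le, ENNReal.mul_rpow_of_nonneg _ _ hp₁.le, hm, hLp₁]
        ring
      _ ≤ (2 * N₂ : ℝ≥0) ^ p₁ * (t ^ s * P ^ s) * 2 ^ d *
          ((K * ((45 : ℝ) ^ d).toNNReal ^ q : ℝ≥0) * μ (ball x R)) := by
        rw [havg]; gcongr
      _ = _ := by
        rw [ENNReal.coe_mul _ (K * ((45 : ℝ) ^ d).toNNReal ^ q), ENNReal.coe_mul _ (2 ^ d),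
          ENNReal.coe_mul _ (P ^ s), ENNReal.coe_rpow_of_nonneg _ hp₁.le,
          ENNReal.coe_rpow_of_nonneg _ hs0.le, ENNReal.coe_pow, ENNReal.coe_ofNat]
        ring

end LocalStep

/-! ### Degenerate weights, choice of constants and conclusion. -/

section Conclusion

variable {d : ℕ}

theorem mul_rpow_lintegral_le_of_apConstant_le {q : ℝ} (hq : 1 < q) {K : ℝ≥0} {ω : E d → ℝ}
    (hK : apConstant q ω ≤ K) {y : E d} {r : ℝ} (hr : 0 < r) :
    (∫⁻ x in ball y r, ENNReal.ofReal (ω x)) *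
      (∫⁻ x in ball y r, ENNReal.ofReal (ω x) ^ (-(1 / (q - 1)))) ^ (q - 1) ≤
        K * volume (ball y r) ^ q := by
  have hV0 : volume (ball y r) ≠ 0 := volume_ball_ne_zero y hr
  have hV1 : volume (ball y r) ≠ ∞ := volume_ball_ne_top y r
  have h : (⨍⁻ x in ball y r, ENNReal.ofReal (ω x) ∂volume) *
      (⨍⁻ x in ball y r, ENNReal.ofReal (ω x) ^ (-(1 / (q - 1))) ∂volume) ^ (q - 1) ≤ K := by
    refine le_trans ?_ hK
    exact le_iSup_of_le y (le_iSup_of_le r (le_iSup_of_le hr le_rfl))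
  have hmul : ∀ u : E d → ℝ≥0∞, ∫⁻ x in ball y r, u x =
      (⨍⁻ x in ball y r, u x ∂volume) * volume (ball y r) := fun u => by
    rw [setLAverage_eq, ENNReal.div_mul_cancel hV0 hV1]
  have hVq : volume (ball y r) ^ q = volume (ball y r) * volume (ball y r) ^ (q - 1) := by
    nth_rw 2 [← ENNReal.rpow_one (volume (ball y r))]
    rw [← ENNReal.rpow_add _ _ hV0 hV1]
    congr 1; ring
  rw [hmul, hmul, ENNReal.mul_rpow_of_nonneg _ _ (by linarith), hVq]
  calc _ = (⨍⁻ x in ball y r, ENNReal.ofReal (ω x) ∂volume) *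
      (⨍⁻ x in ball y r, ENNReal.ofReal (ω x) ^ (-(1 / (q - 1))) ∂volume) ^ (q - 1) *
      (volume (ball y r) * volume (ball y r) ^ (q - 1)) := by ring
    _ ≤ _ := by gcongr

/-- An `A_q` weight either vanishes almost everywhere or is non-degenerate. -/
theorem IsApWeight.eq_zero_or_nondegenerate {q : ℝ} (hq : 1 < q) {K : ℝ≥0} {ω : E d → ℝ}
    (h : IsApWeight q ω) (hK : apConstant q ω ≤ K) :
    (∀ y r, ∫⁻ x in ball y r, ENNReal.ofReal (ω x) = 0) ∨
      ∃ w : E d → ℝ≥0∞, (fun x => ENNReal.ofReal (ω x)) =ᵐ[volume] w ∧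
        IsNondegenerateAp q K w := by
  have hm : AEMeasurable fun x => ENNReal.ofReal (ω x) :=
    h.locallyIntegrable.aestronglyMeasurable.aemeasurable.ennreal_ofReal
  have hexp : -(1 / (q - 1)) < 0 := neg_lt_zero.2 (one_div_pos.2 (by linarith))
  -- If `ω` vanishes on one ball, the dual integral is infinite on every larger ball, and the A_q
  -- bound forces `ω` to vanish there too.
  by_cases hz : ∃ y r, 0 < r ∧ ∫⁻ x in ball y r, ENNReal.ofReal (ω x) = 0
  · left
    obtain ⟨y₁, r₁, hr₁, hz⟩ := hz
    intro y r
    set R := dist y y₁ + max r r₁ with hR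
    have hR0 : 0 < R := by
      have := le_max_right r r₁
      have := dist_nonneg (x := y) (y := y₁)
      linarith
    have hsub : ball y r ⊆ ball y₁ R :=
      ball_subset_ball' (by rw [hR, add_comm]; gcongr; exact le_max_left _ _)
    have hsub₁ : ball y₁ r₁ ⊆ ball y₁ R :=
      ball_subset_ball ((le_max_right r r₁).trans (le_add_of_nonneg_left dist_nonneg))
    have htop : ∫⁻ x in ball y₁ R, ENNReal.ofReal (ω x) ^ (-(1 / (q - 1))) = ∞ := by
      rw [← top_le_iff]
      refine le_trans ?_ (lintegral_mono_set hsub₁)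
      have hae := (lintegral_eq_zero_iff' hm.restrict).1 hz
      have : ∫⁻ x in ball y₁ r₁, ENNReal.ofReal (ω x) ^ (-(1 / (q - 1))) =
          ∫⁻ x in ball y₁ r₁, ∞ := by
        refine lintegral_congr_ae ?_
        filter_upwards [hae] with x hx
        rw [hx, Pi.zero_apply, ENNReal.zero_rpow_of_neg hexp]
      rw [this, setLIntegral_const, ENNReal.top_mul (volume_ball_ne_zero y₁ hr₁)]
    have hle := mul_rpow_lintegral_le_of_apConstant_le hq hK (y := y₁) hR0
    rw [htop, ENNReal.top_rpow_of_pos (by linarith)] at hle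
    have h0 : ∫⁻ x in ball y₁ R, ENNReal.ofReal (ω x) = 0 := by
      by_contra hne
      rw [ENNReal.mul_top hne, top_le_iff] at hle
      exact ENNReal.mul_ne_top ENNReal.coe_ne_top
        (ENNReal.rpow_ne_top_of_nonneg (by linarith) (volume_ball_ne_top _ _)) hle
    exact le_antisymm ((lintegral_mono_set hsub).trans_eq h0) zero_le
  · right
    push Not at hz
    have hcongr : ∀ y r, ∫⁻ x in ball y r, hm.mk _ x = ∫⁻ x in ball y r, ENNReal.ofReal (ω x) :=
      fun y r => lintegral_congr_ae (ae_restrict_of_ae hm.ae_eq_mk.symm)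
    refine ⟨hm.mk _, hm.ae_eq_mk, hm.measurable_mk, fun y r hr => ?_, fun y r hr => ?_,
      fun y r hr => ?_⟩
    · rw [hcongr]; exact hz y r hr
    · rw [hcongr]
      have hint : IntegrableOn ω (ball y r) :=
        (h.locallyIntegrable.integrableOn_isCompact (isCompact_closedBall y r)).mono_set
          ball_subset_closedBall
      exact ((hasFiniteIntegral_iff_ofReal (ae_of_all _ h.nonneg)).1 hint.2).ne
    · have hcongr' : ∫⁻ x in ball y r, hm.mk _ x ^ (-(1 / (q - 1))) =
          ∫⁻ x in ball y r, ENNReal.ofReal (ω x) ^ (-(1 / (q - 1))) := by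
        refine lintegral_congr_ae (ae_restrict_of_ae ?_)
        filter_upwards [hm.ae_eq_mk] with x hx
        rw [hx]
      rw [hcongr, hcongr']
      exact mul_rpow_lintegral_le_of_apConstant_le hq hK hr

/-- This is where `p < p₁` enters: `A ^ (q - s)` tends to 0. -/
theorem exists_rpow_mul_le {q s : ℝ} (hqs : q < s) (B C : ℝ≥0) :
    ∃ A : ℝ≥0, 1 < A ∧ B ≤ A ∧ A ^ q * (C * A ^ (-s)) ≤ 4⁻¹ := by
  have ht : Filter.Tendsto (fun x : ℝ => (C : ℝ) * x ^ (-(s - q))) Filter.atTop (nhds 0) := by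
    simpa using (tendsto_rpow_neg_atTop (by linarith : 0 < s - q)).const_mul (C : ℝ)
  obtain ⟨x, h1, h2, h3⟩ := ((ht.eventually (gt_mem_nhds (by norm_num : (0 : ℝ) < 4⁻¹))).and
    ((Filter.eventually_gt_atTop 1).and (Filter.eventually_ge_atTop (B : ℝ)))).exists
  have hx : 0 < x := by linarith
  lift x to ℝ≥0 using hx.le
  refine ⟨x, by exact_mod_cast h2, by exact_mod_cast h3, ?_⟩
  rw [← NNReal.coe_le_coe]
  push_cast
  refine le_trans (le_of_eq ?_) h1.le
  have : -(s - q) = q + -s := by ring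
  rw [this, Real.rpow_add hx]
  ring

set_option maxHeartbeats 800000 in
/-- The conclusion in integral form, for a non-degenerate weight. -/
theorem exists_lintegral_rpow_mul_le (hd : 0 < d) {p₀ p p₁ : ℝ} (hp₀ : 0 < p₀) (hp : p₀ < p)
    (hp₁ : p < p₁) {c₁ : ℝ} (hc₁ : 0 < c₁) (N₂ K : ℝ≥0) {θ : ℝ≥0} (hθ : 0 < θ) :
    ∃ κ : ℝ, 0 < κ ∧ ∃ η₀ : ℝ≥0, 0 < η₀ ∧ ∀ N₁ : ℝ≥0, 0 < N₁ → ∃ C : ℝ≥0,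
      ∀ w : E d → ℝ≥0∞, IsNondegenerateAp (p / p₀) K w → ∀ ω : E d → ℝ,
      (fun x => ENNReal.ofReal (ω x)) =ᵐ[volume] w → ∀ Ω : Set (E d), IsOpen Ω →
      ∀ (x₀ : E d) (r₀ : ℝ), 0 < r₀ →
      (∀ y ∈ closure Ω, ∀ r, 0 < r → r ≤ 4 * r₀ →
        θ * volume (ball y r) ≤ volume (ball y r ∩ Ω)) →
      ∀ F f : E d → ℝ, AEMeasurable F (volume.restrict (ball x₀ (4 * r₀) ∩ Ω)) →
      AEMeasurable f (volume.restrict (ball x₀ (4 * r₀) ∩ Ω)) →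
      ∫⁻ x in ball x₀ (4 * r₀) ∩ Ω, ‖F x‖ₑ ^ p₀ ≠ 0 →
      ∫⁻ x in ball x₀ (4 * r₀) ∩ Ω, ‖F x‖ₑ ^ p₀ ≠ ∞ →
      ∀ η : ℝ≥0, η ≤ η₀ →
      (∀ (y₀ : E d) (r : ℝ), 0 < r → volume (ball y₀ r) ≤ ENNReal.ofReal (c₁ * r₀ ^ d) →
        ball y₀ (8 * r) ⊆ ball x₀ (4 * r₀) →
        (y₀ ∈ ball x₀ (2 * r₀) ∩ frontier Ω ∨ ball y₀ (4 * r) ⊆ ball x₀ (2 * r₀) ∩ Ω) →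
        ∃ F_B R_B : E d → ℝ,
          AEMeasurable F_B (volume.restrict (ball y₀ (2 * r) ∩ Ω)) ∧
          AEMeasurable R_B (volume.restrict (ball y₀ (2 * r) ∩ Ω)) ∧
          (∀ᵐ x ∂(volume.restrict (ball y₀ (2 * r) ∩ Ω)), |F x| ≤ |F_B x| + |R_B x|) ∧
          lpAvg p₀ (ball y₀ (2 * r) ∩ Ω) F_B ≤
            N₁ * supLpAvg p₀ Ω (ball y₀ r) (ball x₀ (4 * r₀)) f +
              η * lpAvg p₀ (ball y₀ (8 * r) ∩ Ω) F ∧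
          weightedLpAvg p₁ ω (ball y₀ (2 * r) ∩ Ω) R_B ≤
            N₂ * (lpAvg p₀ (ball y₀ (8 * r) ∩ Ω) F +
                supLpAvg p₀ Ω (ball y₀ r) (ball x₀ (4 * r₀)) f) *
              (⨍⁻ x in ball y₀ r, ENNReal.ofReal (ω x) ∂volume) ^ (1 / p₁)) →
      ∫⁻ x in ball x₀ r₀ ∩ Ω, ‖F x‖ₑ ^ p * ENNReal.ofReal (ω x) ≤
        C * (((∫⁻ x in ball x₀ (4 * r₀) ∩ Ω, ‖F x‖ₑ ^ p₀) / volume (ball x₀ (κ * r₀))) ^ (p / p₀) *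
            (∫⁻ x in ball x₀ r₀, ENNReal.ofReal (ω x)) +
          ∫⁻ x in ball x₀ (4 * r₀) ∩ Ω, ‖f x‖ₑ ^ p * ENNReal.ofReal (ω x)) := by
  set q := p / p₀ with hqdef
  have hq : 1 < q := (one_lt_div hp₀).2 hp
  have hq0 : 0 < q := by linarith
  have hp0 : 0 < p := hp₀.trans hp
  have hqs : q < p₁ / p₀ := by rw [hqdef]; gcongr
  have hp₀q : p₀ * q = p := mul_div_cancel₀ _ hp₀.ne'
  set P : ℝ≥0 := 6 ^ d * θ⁻¹ with hP
  have hP0 : 0 < P := by positivity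
  obtain ⟨C₂, A₀, hlocal⟩ := exists_local_maxSet_le hd hq hqs K (2 ^ p₀)
    ((2 * N₂) ^ p₁ * P ^ (p₁ / p₀) * 2 ^ d * (K * ((45 : ℝ) ^ d).toNNReal ^ q))
    (NNReal.rpow_pos (by norm_num))
  set D : ℝ≥0 := K * ((12 : ℝ) ^ d).toNNReal ^ q with hD
  obtain ⟨A, hA1, hA, hAC⟩ := exists_rpow_mul_le hqs (max (2 ^ d) A₀) (D * C₂)
  have hAq : 0 < A ^ q := NNReal.rpow_pos (zero_lt_one.trans hA1)
  set ε : ℝ≥0 := 4⁻¹ / (A ^ q * (D + 1)) with hε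
  have hε0 : 0 < ε := by positivity
  have hεA : A ^ q * D * (ε + C₂ * A ^ (-(p₁ / p₀))) ≤ 2⁻¹ := by
    have h1 : A ^ q * D * ε ≤ 4⁻¹ := by
      calc _ ≤ A ^ q * (D + 1) * ε := by gcongr; simp
        _ = 4⁻¹ := by rw [hε]; field_simp
    calc _ = A ^ q * D * ε + A ^ q * (D * C₂ * A ^ (-(p₁ / p₀))) := by ring
      _ ≤ 4⁻¹ + 4⁻¹ := add_le_add h1 hAC
      _ = 2⁻¹ := by
        rw [← NNReal.coe_inj]; push_cast; norm_num
  obtain ⟨δ, hδ0, hlocal⟩ := hlocal ε hε0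
  set v := (volume (ball (0 : E d) 1)).toReal with hv
  have hv0 : 0 ≤ v := ENNReal.toReal_nonneg
  -- Stopping radii are below `κ * r₀`, so the balls in the hypothesis have radius at most `25 * κ *
  -- r₀`; the second bound makes their volume at most `c₁ * r₀ ^ d`.
  set κ := min (1 / 100) (c₁ / (25 * (v + 1))) with hκ
  have hκ0 : 0 < κ := by positivity
  have hκ1 : κ ≤ 1 / 100 := min_le_left _ _
  have hκv : 25 * κ * v ≤ c₁ := by
    have : κ ≤ c₁ / (25 * (v + 1)) := min_le_right _ _
    rw [le_div_iff₀ (by positivity)] at this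
    nlinarith
  -- Half of the allowed size of `F_B` is for the `η` term, half for the `f` term, which `γ` will
  -- make small; so `η₀` does not involve `N₁`.
  set η₀ : ℝ≥0 := (δ / (P * 50 ^ d)) ^ (1 / p₀) / 2 with hη₀
  have hη₀0 : 0 < η₀ := div_pos (NNReal.rpow_pos (by positivity)) two_pos
  have hη₀δ : (η₀ + η₀) ^ p₀ * P * 50 ^ d ≤ δ := by
    have : η₀ + η₀ = (δ / (P * 50 ^ d)) ^ (1 / p₀) := by rw [hη₀, add_halves]
    rw [this, ← NNReal.rpow_mul, one_div_mul_cancel hp₀.ne', NNReal.rpow_one]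
    exact le_of_eq (by field_simp)
  refine ⟨κ, hκ0, η₀, hη₀0, fun N₁ hN₁ => ?_⟩
  set γ : ℝ≥0 := min 1 ((η₀ / N₁) ^ p₀) with hγ
  have hγ0 : 0 < γ := lt_min one_pos (NNReal.rpow_pos (by positivity))
  have hγ1 : γ ≤ 1 := min_le_left _ _
  have hγN : N₁ * γ ^ (1 / p₀) ≤ η₀ := by
    calc N₁ * γ ^ (1 / p₀) ≤ N₁ * ((η₀ / N₁) ^ p₀) ^ (1 / p₀) := by
          gcongr
          exact min_le_right _ _
      _ = η₀ := by
        rw [← NNReal.rpow_mul, mul_one_div_cancel hp₀.ne', NNReal.rpow_one,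
          mul_div_cancel₀ _ hN₁.ne']
  obtain ⟨C, hC⟩ := exists_lintegral_rpow_le_of_good_lambda hd hq K D hA1 hγ0 hεA
  refine ⟨C, fun w hw ω hω Ω hΩ x₀ r₀ hr₀ hdens F f hF hf hF0 hFtop η hη hdecomp => ?_⟩
  have hκr : 100 * (κ * r₀) ≤ r₀ := by nlinarith only [hκ1, hr₀]
  have hκr₀ : κ * r₀ ≤ r₀ := by nlinarith only [hκ1, hr₀]
  have hm : MeasurableSet (ball x₀ (4 * r₀) ∩ Ω) := measurableSet_ball.inter hΩ.measurableSet
  set g : E d → ℝ≥0∞ := (ball x₀ (4 * r₀) ∩ Ω).indicator fun x => ‖F x‖ₑ ^ p₀ with hg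
  set h : E d → ℝ≥0∞ := (ball x₀ (4 * r₀) ∩ Ω).indicator fun x => ‖f x‖ₑ ^ p₀ with hh
  have hgm : AEMeasurable g := (aemeasurable_indicator_iff hm).2 (hF.enorm.pow_const _)
  have hhm : AEMeasurable h := (aemeasurable_indicator_iff hm).2 (hf.enorm.pow_const _)
  have hgint : ∫⁻ x, g x = ∫⁻ x in ball x₀ (4 * r₀) ∩ Ω, ‖F x‖ₑ ^ p₀ := lintegral_indicator hm _
  set V := volume (ball x₀ (κ * r₀)) with hV
  have hV0 : V ≠ 0 := volume_ball_ne_zero x₀ (by positivity)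
  have hV1 : V ≠ ∞ := volume_ball_ne_top _ _
  rw [← hgint] at hF0 hFtop ⊢
  -- From this level on, every stopping radius is below `κ * r₀`.
  set l := (∫⁻ x, g x) / V with hl
  have hl0 : l ≠ 0 := ENNReal.div_ne_zero.2 ⟨hF0, hV1⟩
  have hl1 : l ≠ ∞ := ENNReal.div_ne_top hFtop hV0
  have hlV : l * V = ∫⁻ x, g x := ENNReal.div_mul_cancel hV0 hV1
  have hgfin : ∀ x, g x ≠ ∞ := fun x => by
    refine ((indicator_le_self' (fun _ _ => zero_le) x).trans_lt ?_).ne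
    exact ENNReal.rpow_lt_top_of_nonneg hp₀.le enorm_ne_top
  have hpow : ∀ (u : E d → ℝ) (x : E d),
      (ball x₀ (4 * r₀) ∩ Ω).indicator (fun x => ‖u x‖ₑ ^ p₀) x ^ q =
        (ball x₀ (4 * r₀) ∩ Ω).indicator (fun x => ‖u x‖ₑ ^ p) x := fun u x => by
    by_cases hx : x ∈ ball x₀ (4 * r₀) ∩ Ω
    · rw [indicator_of_mem hx, indicator_of_mem hx, ← ENNReal.rpow_mul, hp₀q]
    · rw [indicator_of_notMem hx, indicator_of_notMem hx, ENNReal.zero_rpow_of_pos hq0]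
  have hweight : ∀ (u : E d → ℝ) (x : E d), ENNReal.ofReal (ω x) = w x →
      (ball x₀ (4 * r₀) ∩ Ω).indicator (fun x => ‖u x‖ₑ ^ p₀) x ^ q * w x =
        (ball x₀ (4 * r₀) ∩ Ω).indicator (fun x => ‖u x‖ₑ ^ p * ENNReal.ofReal (ω x)) x :=
    fun u x hx => by
      rw [hpow, ← hx]
      by_cases hx' : x ∈ ball x₀ (4 * r₀) ∩ Ω
      · rw [indicator_of_mem hx', indicator_of_mem hx']
      · rw [indicator_of_notMem hx', indicator_of_notMem hx', zero_mul]
  have hmain := hC w hw x₀ r₀ (4 * r₀) g h l hr₀ (by positivity) hgm hhm hFtop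
    (ae_of_all _ hgfin) hl0 hl1 (fun t hlt ht => ?_)
  · have h1 : ∫⁻ x in ball x₀ r₀ ∩ Ω, ‖F x‖ₑ ^ p * ENNReal.ofReal (ω x) =
        ∫⁻ x in ball x₀ r₀, g x ^ q * w x := by
      rw [← setLIntegral_indicator_inter hm (ball_subset_ball (by linarith))]
      refine lintegral_congr_ae (ae_restrict_of_ae ?_)
      filter_upwards [hω] with x hx using (hweight F x hx).symm
    have h2 : ∫⁻ x in ball x₀ (4 * r₀) ∩ Ω, ‖f x‖ₑ ^ p * ENNReal.ofReal (ω x) =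
        ∫⁻ x, h x ^ q * w x := by
      rw [← lintegral_indicator hm]
      refine lintegral_congr_ae ?_
      filter_upwards [hω] with x hx using (hweight f x hx).symm
    have h3 : ∫⁻ x in ball x₀ r₀, ENNReal.ofReal (ω x) = volume.withDensity w (ball x₀ r₀) := by
      rw [withDensity_apply _ measurableSet_ball]
      exact lintegral_congr_ae (ae_restrict_of_ae hω)
    rw [h1, h2, h3]
    exact hmain
  · have ht0 : t ≠ 0 := fun h0 => hl0 (le_antisymm (hlt.trans_eq h0) zero_le)
    refine hw.good_lambda (ρ := κ * r₀) hq ((le_max_left _ _).trans hA) hκr₀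
      (le_mul_of_one_le_left hr₀.le (by norm_num)) ?_ ?_
    · rw [← hlV]; gcongr
    · intro x hx R hR hRκ hlow hbig
      have hRr : 100 * R ≤ r₀ := by linarith only [hRκ, hκr]
      have hmaj := hw.exists_majorant hd hp₀ (hp0.trans hp₁) hq hω hΩ hθ hdens
        (N₁ := N₁) (N₂ := N₂) (η := η) (γ := γ) (δ := δ) hγ1 (by
          refine le_trans ?_ hη₀δ
          gcongr) (F := F) (f := f) hx hR hRr (t := t) (ne_of_gt (zero_le.trans_lt hlow)) hbig
        (fun y r hr hr25 h8 hcase => hdecomp y r hr (by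
          rw [volume_ball_eq y hr, ← ENNReal.ofReal_toReal (volume_ball_ne_top (0 : E d) 1),
            ← ENNReal.ofReal_mul (by positivity)]
          refine ENNReal.ofReal_le_ofReal ?_
          have hrκ : r ≤ 25 * κ * r₀ := by linarith only [hr25, hRκ]
          have hκ25 : 25 * κ ≤ 1 := by linarith only [hκ1]
          calc r ^ d * v ≤ (25 * κ * r₀) ^ d * v := by gcongr
            _ = (25 * κ) ^ d * v * r₀ ^ d := by rw [mul_pow]; ring
            _ ≤ 25 * κ * v * r₀ ^ d := by
              gcongr
              exact pow_le_of_le_one (by positivity) hκ25 hd.ne'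
            _ ≤ c₁ * r₀ ^ d := by gcongr) h8 hcase)
      rcases hmaj with hsub | ⟨g₁, g₂, hg₁, hg₂, hdom, h₁, h₂⟩
      · exact Or.inl hsub
      · exact Or.inr (hlocal w hw A ((le_max_right _ _).trans hA) x R (4 * r₀) t g g₁ g₂ hR ht0 ht
          hg₁ hg₂ hdom h₁ h₂ hbig)

/-- Normalisation only: the volumes of `ball x₀ (κ * r₀)`, `ball x₀ (4 * r₀)` and `ball x₀ r₀ ∩ Ω`
are compared with that of `ball x₀ r₀`. -/
theorem weightedLpAvg_le_of_lintegral_le {p₀ p : ℝ} (hp₀ : 0 < p₀) (hp : 0 < p) {θ : ℝ≥0}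
    (hθ : 0 < θ) {κ : ℝ} (hκ : 0 < κ) (C : ℝ≥0) :
    ∃ C' : ℝ, 0 < C' ∧ ∀ (ω F f : E d → ℝ) (Ω : Set (E d)) (x₀ : E d) (r₀ : ℝ), 0 < r₀ →
      θ * volume (ball x₀ r₀) ≤ volume (ball x₀ r₀ ∩ Ω) →
      ∫⁻ x in ball x₀ r₀ ∩ Ω, ‖F x‖ₑ ^ p * ENNReal.ofReal (ω x) ≤
        C * (((∫⁻ x in ball x₀ (4 * r₀) ∩ Ω, ‖F x‖ₑ ^ p₀) / volume (ball x₀ (κ * r₀))) ^ (p / p₀) *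
            (∫⁻ x in ball x₀ r₀, ENNReal.ofReal (ω x)) +
          ∫⁻ x in ball x₀ (4 * r₀) ∩ Ω, ‖f x‖ₑ ^ p * ENNReal.ofReal (ω x)) →
      weightedLpAvg p ω (ball x₀ r₀ ∩ Ω) F ≤
        ENNReal.ofReal C' * weightedLpAvg p ω (ball x₀ (4 * r₀) ∩ Ω) f +
          ENNReal.ofReal C' * lpAvg p₀ (ball x₀ (4 * r₀) ∩ Ω) F *
            (⨍⁻ x in ball x₀ r₀, ENNReal.ofReal (ω x) ∂volume) ^ (1 / p) := by
  set q := p / p₀ with hq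
  have hq0 : 0 < q := by positivity
  set G : ℝ≥0 := ((4 / κ) ^ d).toNNReal ^ q with hG
  set Z : ℝ≥0 := 2 * (C * (G + 4 ^ d) * θ⁻¹) + 1 with hZ
  set c : ℝ≥0 := Z ^ (1 / p) with hc
  have hc0 : 0 < c := NNReal.rpow_pos (by positivity)
  have hcp : (c : ℝ≥0∞) ^ p = Z := by
    rw [← ENNReal.coe_rpow_of_nonneg _ hp.le, hc, ← NNReal.rpow_mul, one_div_mul_cancel hp.ne',
      NNReal.rpow_one]
  refine ⟨c, by exact_mod_cast hc0, fun ω F f Ω x₀ r₀ hr₀ hdens hle => ?_⟩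
  rw [ENNReal.ofReal_coe_nnreal]
  set a := weightedLpAvg p ω (ball x₀ (4 * r₀) ∩ Ω) f with ha
  set b := lpAvg p₀ (ball x₀ (4 * r₀) ∩ Ω) F with hb
  set m := ⨍⁻ x in ball x₀ r₀, ENNReal.ofReal (ω x) ∂volume with hm
  set V := volume (ball x₀ r₀) with hV
  have hV0 : V ≠ 0 := volume_ball_ne_zero x₀ hr₀
  have hV1 : V ≠ ∞ := volume_ball_ne_top _ _
  have hS0 : volume (ball x₀ r₀ ∩ Ω) ≠ 0 := volume_ball_inter_ne_zero hθ hr₀ hdens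
  have hS1 : volume (ball x₀ r₀ ∩ Ω) ≠ ∞ :=
    ((measure_mono inter_subset_left).trans_lt measure_ball_lt_top).ne
  have hD0 : volume (ball x₀ (4 * r₀) ∩ Ω) ≠ 0 := fun h0 =>
    hS0 (measure_mono_null (inter_subset_inter_left _ (ball_subset_ball (by linarith))) h0)
  have hD1 : volume (ball x₀ (4 * r₀) ∩ Ω) ≠ ∞ :=
    ((measure_mono inter_subset_left).trans_lt measure_ball_lt_top).ne
  have hDV : volume (ball x₀ (4 * r₀) ∩ Ω) ≤ 4 ^ d * V := by
    refine (measure_mono inter_subset_left).trans_eq ?_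
    rw [volume_ball_mul x₀ x₀ (by norm_num) hr₀, ENNReal.ofReal_pow (by norm_num),
      ENNReal.ofReal_ofNat]
  have hf : ∫⁻ x in ball x₀ (4 * r₀) ∩ Ω, ‖f x‖ₑ ^ p * ENNReal.ofReal (ω x) ≤
      a ^ p * (4 ^ d * V) :=
    ((setLAverage_rpow_le_iff hD0 hD1 hp).1 le_rfl).trans (by gcongr; rfl)
  have hF : (∫⁻ x in ball x₀ (4 * r₀) ∩ Ω, ‖F x‖ₑ ^ p₀) / volume (ball x₀ (κ * r₀)) ≤
      b ^ p₀ * ((4 / κ) ^ d).toNNReal := by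
    refine ENNReal.div_le_of_le_mul ?_
    refine ((setLAverage_rpow_le_iff hD0 hD1 hp₀).1 le_rfl).trans ?_
    rw [mul_assoc]
    gcongr
    · rfl
    · refine (measure_mono inter_subset_left).trans_eq ?_
      have : 4 * r₀ = 4 / κ * (κ * r₀) := by field_simp
      rw [this]
      exact volume_ball_mul x₀ x₀ (by positivity) (by positivity)
  have hFq : ((∫⁻ x in ball x₀ (4 * r₀) ∩ Ω, ‖F x‖ₑ ^ p₀) / volume (ball x₀ (κ * r₀))) ^ q ≤
      b ^ p * G := by
    refine (ENNReal.rpow_le_rpow hF hq0.le).trans_eq ?_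
    rw [ENNReal.mul_rpow_of_nonneg _ _ hq0.le, ← ENNReal.rpow_mul, hq, mul_div_cancel₀ _ hp₀.ne',
      hG, ENNReal.coe_rpow_of_nonneg _ hq0.le]
  have hmV : ∫⁻ x in ball x₀ r₀, ENNReal.ofReal (ω x) = m * V := by
    rw [hm, setLAverage_eq, ENNReal.div_mul_cancel hV0 hV1]
  have hmp : (m ^ (1 / p)) ^ p = m := by
    rw [← ENNReal.rpow_mul, one_div_mul_cancel hp.ne', ENNReal.rpow_one]
  have hVS : V ≤ (θ⁻¹ : ℝ≥0) * volume (ball x₀ r₀ ∩ Ω) := by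
    calc V = (θ⁻¹ : ℝ≥0) * (θ * V) := by
          rw [← mul_assoc, ← ENNReal.coe_mul, inv_mul_cancel₀ hθ.ne', ENNReal.coe_one, one_mul]
      _ ≤ _ := by gcongr
  -- Only monotonicity of the power is used, so `p < 1` is allowed.
  have hsum : a ^ p + b ^ p * m ≤ 2 * (a + b * m ^ (1 / p)) ^ p := by
    have hbm : b ^ p * m = (b * m ^ (1 / p)) ^ p := by
      rw [ENNReal.mul_rpow_of_nonneg _ _ hp.le, hmp]
    rw [hbm, two_mul]
    gcongr
    · exact le_self_add
    · exact le_add_self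
  rw [weightedLpAvg, setLAverage_rpow_le_iff hS0 hS1 hp]
  refine hle.trans ?_
  rw [hmV]
  calc _ ≤ C * (b ^ p * G * (m * V) + a ^ p * (4 ^ d * V)) := by gcongr
    _ ≤ C * (b ^ p * G * (m * V) + a ^ p * (4 ^ d * V)) +
        C * (a ^ p * G * V + b ^ p * m * 4 ^ d * V) := le_self_add
    _ = C * (G + 4 ^ d) * (a ^ p + b ^ p * m) * V := by ring
    _ ≤ C * (G + 4 ^ d) * (2 * (a + b * m ^ (1 / p)) ^ p) *
        ((θ⁻¹ : ℝ≥0) * volume (ball x₀ r₀ ∩ Ω)) := by gcongr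
    _ = (2 * (C * (G + 4 ^ d) * θ⁻¹) : ℝ≥0) * (a + b * m ^ (1 / p)) ^ p *
        volume (ball x₀ r₀ ∩ Ω) := by
      clear_value G
      push_cast
      ring
    _ ≤ Z * (a + b * m ^ (1 / p)) ^ p * volume (ball x₀ r₀ ∩ Ω) := by
      gcongr
      exact le_self_add
    _ = _ := by
      rw [← hcp, ← ENNReal.mul_rpow_of_nonneg _ _ hp.le, mul_add, mul_assoc (c : ℝ≥0∞) b]

end Conclusion

theorem theorem4p1 (d : ℕ) (p₀ p p₁ : ℝ) (hp₀ : 0 < p₀) (hp : p₀ < p) (hp₁ : p < p₁)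
    (c₀ c₁ N₂ : ℝ) (hc₀ : 0 < c₀) (hc₁ : 0 < c₁) (hc₁' : c₁ < 1) (hN₂ : 1 < N₂)
    -- bound for the weight constant, and the Lipschitz character
    (K : ℝ≥0) (M : ℝ≥0) (ρ : ℝ) (hρ : 0 < ρ) :
    ∃ η₀ : ℝ, 0 < η₀ ∧ ∀ N₁ : ℝ, 1 < N₁ → ∃ C : ℝ, 0 < C ∧
      ∀ (Ω : Set (E d)), IsLipschitzDomainWith M ρ Ω →
      ∀ (ω : E d → ℝ), IsApWeight (p / p₀) ω → apConstant (p / p₀) ω ≤ K →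
      ∀ (x₀ : E d) (r₀ : ℝ), x₀ ∈ frontier Ω → 0 < r₀ → r₀ < c₀ * diam Ω →
      ∀ (F f : E d → ℝ),
        MemLp F (ENNReal.ofReal p) (volume.restrict (ball x₀ (4 * r₀) ∩ Ω)) →
        MemLp f (ENNReal.ofReal p) (volume.restrict (ball x₀ (4 * r₀) ∩ Ω)) →
      ∀ (η : ℝ), 0 ≤ η → η ≤ η₀ →
        (∀ (y₀ : E d) (r : ℝ), 0 < r →
          volume (ball y₀ r) ≤ ENNReal.ofReal (c₁ * r₀ ^ d) →
          ball y₀ (8 * r) ⊆ ball x₀ (4 * r₀) →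
          (y₀ ∈ ball x₀ (2 * r₀) ∩ frontier Ω ∨
            ball y₀ (4 * r) ⊆ ball x₀ (2 * r₀) ∩ Ω) →
          ∃ F_B R_B : E d → ℝ,
            AEMeasurable F_B (volume.restrict (ball y₀ (2 * r) ∩ Ω)) ∧
            AEMeasurable R_B (volume.restrict (ball y₀ (2 * r) ∩ Ω)) ∧
            (∀ᵐ x ∂(volume.restrict (ball y₀ (2 * r) ∩ Ω)), |F x| ≤ |F_B x| + |R_B x|) ∧
            lpAvg p₀ (ball y₀ (2 * r) ∩ Ω) F_B ≤
              ENNReal.ofReal N₁ * supLpAvg p₀ Ω (ball y₀ r) (ball x₀ (4 * r₀)) f +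
                ENNReal.ofReal η * lpAvg p₀ (ball y₀ (8 * r) ∩ Ω) F ∧
            weightedLpAvg p₁ ω (ball y₀ (2 * r) ∩ Ω) R_B ≤
              ENNReal.ofReal N₂ *
                (lpAvg p₀ (ball y₀ (8 * r) ∩ Ω) F +
                  supLpAvg p₀ Ω (ball y₀ r) (ball x₀ (4 * r₀)) f) *
                (⨍⁻ x in ball y₀ r, ENNReal.ofReal (ω x) ∂volume) ^ (1 / p₁)) →
        weightedLpAvg p ω (ball x₀ r₀ ∩ Ω) F ≤
          ENNReal.ofReal C * weightedLpAvg p ω (ball x₀ (4 * r₀) ∩ Ω) f +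
            ENNReal.ofReal C * lpAvg p₀ (ball x₀ (4 * r₀) ∩ Ω) F *
              (⨍⁻ x in ball x₀ r₀, ENNReal.ofReal (ω x) ∂volume) ^ (1 / p) := by
  have hp0 : 0 < p := hp₀.trans hp
  have hq : 1 < p / p₀ := (one_lt_div hp₀).2 hp
  -- In dimension 0 the diameter vanishes and no admissible `r₀` exists.
  rcases Nat.eq_zero_or_pos d with rfl | hd
  · refine ⟨1, one_pos, fun _ _ => ⟨1, one_pos, ?_⟩⟩
    intro Ω _ ω _ _ x₀ r₀ _ hr₀ hr₀'
    rw [Metric.diam_subsingleton (subsingleton_of_subsingleton), mul_zero] at hr₀'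
    exact absurd hr₀ hr₀'.not_gt
  obtain ⟨θ, hθ, hdens⟩ := exists_mul_volume_ball_le (d := d) M (c := 4 * c₀) hρ (by positivity)
  obtain ⟨κ, hκ, η₀, hη₀, hcore⟩ :=
    exists_lintegral_rpow_mul_le hd hp₀ hp hp₁ hc₁ N₂.toNNReal K hθ
  refine ⟨η₀, hη₀, fun N₁ hN₁ => ?_⟩
  obtain ⟨C₁, hC₁⟩ := hcore N₁.toNNReal (Real.toNNReal_pos.2 (by linarith))
  obtain ⟨C, hC, hfinal⟩ := weightedLpAvg_le_of_lintegral_le (d := d) hp₀ hp0 hθ hκ C₁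
  refine ⟨C, hC, fun Ω hΩ ω hω hK x₀ r₀ hx₀ hr₀ hr₀' F f hF hf η hη hη' hdecomp => ?_⟩
  have hdens' : ∀ y ∈ closure Ω, ∀ r, 0 < r → r ≤ 4 * r₀ →
      θ * volume (ball y r) ≤ volume (ball y r ∩ Ω) := fun y hy r hr hr4 =>
    hdens Ω hΩ y hy r hr (by linarith)
  refine hfinal ω F f Ω x₀ r₀ hr₀
    (hdens' x₀ (frontier_subset_closure hx₀) r₀ hr₀ (by linarith)) ?_
  set S := ball x₀ (4 * r₀) ∩ Ω with hS
  have hsub : ball x₀ r₀ ∩ Ω ⊆ S :=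
    inter_subset_inter_left _ (ball_subset_ball (by linarith))
  have hSm : MeasurableSet S := measurableSet_ball.inter hΩ.isOpen.measurableSet
  have : IsFiniteMeasure (volume.restrict S) :=
    isFiniteMeasure_restrict.2 ((measure_mono inter_subset_left).trans_lt measure_ball_lt_top).ne
  have hFm := hF.aestronglyMeasurable.aemeasurable
  rcases hω.eq_zero_or_nondegenerate hq hK with hzero | ⟨w, hωw, hw⟩
  · refine le_trans (le_of_eq ?_) zero_le
    have hωm : AEMeasurable fun x => ENNReal.ofReal (ω x) :=
      hω.locallyIntegrable.aestronglyMeasurable.aemeasurable.ennreal_ofReal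
    have hae := (lintegral_eq_zero_iff' hωm.restrict).1 (hzero x₀ r₀)
    refine (lintegral_congr_ae (g := fun _ => 0) ?_).trans lintegral_zero
    filter_upwards [ae_restrict_of_ae_restrict_of_subset inter_subset_left hae] with x hx
    rw [hx, Pi.zero_apply, mul_zero]
  -- Here the base level would be 0, which the sum over levels does not allow; but then `F` vanishes
  -- almost everywhere.
  by_cases hF0 : ∫⁻ x in S, ‖F x‖ₑ ^ p₀ = 0
  · refine le_trans (le_of_eq ?_) zero_le
    have hae := (lintegral_eq_zero_iff' (hFm.enorm.pow_const p₀)).1 hF0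
    refine (lintegral_congr_ae (g := fun _ => 0) ?_).trans lintegral_zero
    filter_upwards [ae_restrict_of_ae_restrict_of_subset hsub hae] with x hx
    have hx0 : ‖F x‖ₑ = 0 := (ENNReal.rpow_eq_zero_iff_of_pos hp₀).1 hx
    rw [hx0, ENNReal.zero_rpow_of_pos hp0, zero_mul]
  have hFtop : ∫⁻ x in S, ‖F x‖ₑ ^ p₀ ≠ ∞ := by
    have h1 : MemLp F (ENNReal.ofReal p₀) (volume.restrict S) :=
      hF.mono_exponent (ENNReal.ofReal_le_ofReal hp.le)
    have h2 := lintegral_rpow_enorm_lt_top_of_eLpNorm_lt_top (by simpa using hp₀)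
      ENNReal.ofReal_ne_top h1.eLpNorm_lt_top
    rw [ENNReal.toReal_ofReal hp₀.le] at h2
    exact h2.ne
  exact hC₁ w hw ω hωw Ω hΩ.isOpen x₀ r₀ hr₀ hdens' F f hFm
    hf.aestronglyMeasurable.aemeasurable hF0 hFtop η.toNNReal
    (Real.toNNReal_le_iff_le_coe.2 hη') hdecomp
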